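/- Let $k\ge 1$. A $k$-graph $\Lambda$ is a countable category with object set $\Lambda^0$ (morphisms are called paths, $r$ and $s$ denote codomain and domain, and each $v\in\Lambda^0$ is identified with its identity morphism) together with a functor $d:\Lambda\to\mathbb N^k$ such that whenever $d(\lambda)=m+n$ there are unique $\mu,\nu$ with $d(\mu)=m$, $d(\nu)=n$ and $\lambda=\mu\nu$. For $p\le q\le d(\lambda)$, $\lambda(p,q)$ denotes the unique path such that $\lambda=\lambda'\lambda(p,q)\lambda''$ with $d(\lambda')=p$ and $d(\lambda(p,q))=q-p$. Write $v\Lambda^n$ for the set of paths of degree $n$ with range $v$. Suppose that $\Lambda^0\neq\emptyset$ and that $\Lambda$ is row-finite without sources, i.e. every $v\Lambda^n$ is finite and nonempty. $\Lambda$ is *aperiodic* if for all $v\in\Lambda^0$ and $m\ne n\in\mathbb N^k$ there is a path $\lambda$ with $r(\lambda)=v$, $d(\lambda)\ge m\vee n$ and $\lambda(m,m+d(\lambda)-(m\vee n))\ne\lambda(n,n+d(\lambda)-(m\vee n))$. An *infinite path* is a degree-preserving functor $x$ to $\Lambda$ from the category $\Omega_k$ with objects $\mathbb N^k$ and one morphism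 $(p,q)$, of range $p$, source $q$ and degree $q-p$, for each $p\le q$. $\Lambda$ is *cofinal* if for every infinite path $x$ and $v\in\Lambda^0$ there is $n\in\mathbb N^k$ such that some path has source $x(n)$ and range $v$. Let $R$ be a commutative ring with $1$. The Kumjian–Pask algebra $\mathrm{KP}_R(\Lambda)$ is the (not necessarily unital) associative $R$-algebra with generators $p_v$ ($v\in\Lambda^0$) and $s_\lambda,s_{\lambda^*}$ ($d(\lambda)\neq0$) and the relations: $p_vp_w=\delta_{v,w}p_v$; for all $\lambda,\mu$ of nonzero degree with $s(\lambda)=r(\mu)$, $s_\lambda s_\mu=s_{\lambda\mu}$ and $s_{\mu^*}s_{\lambda^*}=s_{(\lambda\mu)^*}$; for all $\lambda$ of nonzero degree, $p_{r(\lambda)}s_\lambda=s_\lambda=s_\lambda p_{s(\lambda)}$ and $p_{s(\lambda)}s_{\lambda^*}=s_{\lambda^*}=s_{\lambda^*}p_{r(\lambda)}$; $s_{\lambda^*}s_\mu=\delta_{\lambda,\mu}p_{s(\lambda)}$ for $\lambda,\mu$ of the same nonzero degree; and $p_v=\sum_{\lambda\in v\Lambda^n}s_\lambda s_{\lambda^*}$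 for $v\in\Lambda^0$ and $n\ne0$. Put $s_v=s_{v^*}=p_v$. Let $\mathcal L(A)$ be the lattice of two-sided ideals of a ring $A$, and define $\mathrm{Res}:\mathcal L(\mathrm{KP}_R(\Lambda))\to\mathcal L(R)$ and $\mathrm{Ind}:\mathcal L(R)\to\mathcal L(\mathrm{KP}_R(\Lambda))$ by $$\mathrm{Res}\,I=\{r\in R: rp_v\in I\text{ for all }v\in\Lambda^0\},\qquad \mathrm{Ind}\,M=\operatorname{span}_R\{r s_\alpha s_{\beta^*}: r\in M,\ \alpha,\beta\in\Lambda\}.$$ 1. $\mathrm{Res}\circ\mathrm{Ind}=\mathrm{id}$; in particular $\mathrm{Ind}$ is injective. 2. If $\Lambda$ is aperiodic and cofinal, then $\mathrm{Ind}\circ\mathrm{Res}=\mathrm{id}$, and $\mathrm{Ind}$ is a lattice isomorphism with inverse $\mathrm{Res}$. 3. If $1\ne0$ in $R$, then $\Lambda$ is aperiodic and cofinal if and only if $\mathrm{Ind}\circ\mathrm{Res}=\mathrm{id}$. -/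

import Mathlib

open CategoryTheory

universe u v w

/-- A `k`-graph structure on a category `C`: the category is countable and carries a degree functor
`d` to the one-object category `ℕ^k` with the factorization property.  A morphism `a ⟶ b` is a path
with source `a` and range `b`; thus the composition written `μν` in the literature, where
`s(μ) = r(ν)`, is `ν ≫ μ` here. -/
structure KGraph (k : ℕ) (C : Type u) [Category.{v} C] where
  countable : CountableCategory C
  degree : ∀ {a b : C}, (a ⟶ b) → (Fin k → ℕ)
  degree_id : ∀ a : C, degree (𝟙 a) = 0
  degree_comp : ∀ {a b c : C} (f : a ⟶ b) (g : b ⟶ c), degree (f ≫ g) = degree f + degree g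
  /-- If `d(l) = m + n`, there are unique `μ`, `ν` with `d(μ) = m`, `d(ν) = n` and `l = μν`. -/
  factorization : ∀ {a b : C} (l : a ⟶ b) (m n : Fin k → ℕ), degree l = m + n →
    ∃! p : (c : C) × (a ⟶ c) × (c ⟶ b),
      degree p.2.2 = m ∧ degree p.2.1 = n ∧ p.2.1 ≫ p.2.2 = l

/-- The set of all morphisms (paths) of a category. -/
@[ext]
structure KPath (C : Type u) [Category.{v} C] where
  {source : C}
  {range : C}
  hom : source ⟶ range

namespace KGraph

section Basic

variable {k : ℕ} {C : Type u} [Category.{v} C] (Λ : KGraph k C)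

/-- The degree of a path. -/
def deg (l : KPath C) : Fin k → ℕ := Λ.degree l.hom

/-- `Λ` is row-finite: the set `v Λ^n` of paths of degree `n` with range `v` is always finite. -/
class RowFinite : Prop where
  finite : ∀ (v : C) (n : Fin k → ℕ), {l : KPath C | l.range = v ∧ Λ.deg l = n}.Finite

/-- `Λ` has no sources: the set `v Λ^n` is never empty. -/
class NoSources : Prop where
  exists_path : ∀ (v : C) (n : Fin k → ℕ), ∃ l : KPath C, l.range = v ∧ Λ.deg l = n

/-- For `p ≤ q ≤ d(l)`, the segment `l(p, q)` is the unique `m` with `l = l' m l''`, `d(l') = p` and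
`d(m) = q - p`.  `Λ.IsSegment l p q m` says that `p ≤ q ≤ d(l)` and `l(p, q) = m`. -/
def IsSegment (l : KPath C) (p q : Fin k → ℕ) (m : KPath C) : Prop :=
  ∃ (f : m.range ⟶ l.range) (g : l.source ⟶ m.source),
    Λ.degree f = p ∧ p + Λ.deg m = q ∧ g ≫ m.hom ≫ f = l.hom

/-- The finite-path formulation of aperiodicity: for all `v` and `m ≠ n` there is a path `l` with
range `v` and `d(l) ≥ m ∨ n` such that
`l(m, m + d(l) - (m ∨ n)) ≠ l(n, n + d(l) - (m ∨ n))`. -/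
def Aperiodic : Prop :=
  ∀ (v : C) (m n : Fin k → ℕ), m ≠ n →
    ∃ l : KPath C, l.range = v ∧ m ⊔ n ≤ Λ.deg l ∧
      ∃ x y : KPath C, Λ.IsSegment l m (m + (Λ.deg l - m ⊔ n)) x ∧
        Λ.IsSegment l n (n + (Λ.deg l - m ⊔ n)) y ∧ x ≠ y

theorem eq_id_of_deg_eq_zero {l : KPath C} (h : Λ.deg l = 0) : l = ⟨𝟙 l.range⟩ := by
  obtain ⟨l⟩ := l
  rename_i a b
  have h0 : Λ.degree l = 0 + 0 := by simpa [deg] using h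
  have h1 : (⟨a, 𝟙 a, l⟩ : (c : C) × (a ⟶ c) × (c ⟶ b)) = ⟨b, l, 𝟙 b⟩ :=
    (Λ.factorization l 0 0 h0).unique ⟨by simpa using h0, Λ.degree_id a, Category.id_comp l⟩
      ⟨Λ.degree_id b, by simpa using h0, Category.comp_id l⟩
  obtain rfl : a = b := congrArg Sigma.fst h1
  have h2 := eq_of_heq (Sigma.mk.inj h1).2
  have h3 : 𝟙 a = l := congrArg Prod.fst h2
  rw [← h3]

theorem exists_factor (l : KPath C) (n : Fin k → ℕ) (h : n ≤ Λ.deg l) :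
    ∃ (c : C) (f : c ⟶ l.range) (g : l.source ⟶ c), Λ.degree f = n ∧ g ≫ f = l.hom := by
  obtain ⟨⟨c, g, f⟩, ⟨h1, -, h2⟩, -⟩ :=
    Λ.factorization l.hom n (Λ.deg l - n) (add_tsub_cancel_of_le h).symm
  exact ⟨c, f, g, h1, h2⟩

end Basic

/-- The objects of the `k`-graph `Ω_k`, that is, the points of `ℕ^k`. -/
structure Omega (k : ℕ) where
  pt : Fin k → ℕ

/-- The category `Ω_k`: there is exactly one morphism `(p, q)` with range `p` and source `q` when
`p ≤ q`, and none otherwise. -/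
instance (k : ℕ) : Category (Omega k) where
  Hom a b := PLift (b.pt ≤ a.pt)
  id a := ⟨le_refl a.pt⟩
  comp f g := ⟨g.down.trans f.down⟩

/-- An infinite path in `Λ`: a degree-preserving functor from `Ω_k` to `Λ`, where the degree of the
morphism `(p, q)` of `Ω_k` is `q - p`. -/
structure InfinitePath {k : ℕ} {C : Type u} [Category.{v} C] (Λ : KGraph k C) where
  toFunctor : Omega k ⥤ C
  degree_map : ∀ {a b : Omega k} (f : a ⟶ b), Λ.degree (toFunctor.map f) = a.pt - b.pt

section KumjianPask

variable {k : ℕ} {C : Type u} [Category.{v} C] (Λ : KGraph k C)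

/-- `Λ` is cofinal: for every infinite path `x` and every vertex `v` there is `n` such that some
path has source `x(n)` and range `v`. -/
def Cofinal : Prop :=
  ∀ (x : Λ.InfinitePath) (v : C), ∃ n : Fin k → ℕ, Nonempty (x.toFunctor.obj ⟨n⟩ ⟶ v)

/-- The generators of the Kumjian-Pask algebra: the vertices, the paths of nonzero degree, and a
ghost path for each path of nonzero degree. -/
inductive Gen : Type (max u v)
  | vertex (v : C)
  | path (l : KPath C) (h : Λ.deg l ≠ 0)
  | ghost (l : KPath C) (h : Λ.deg l ≠ 0)

variable (R : Type w) [CommRing R]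

/-- The free (associative, not necessarily unital) `R`-algebra on the generators, with basis the
nonempty words. -/
abbrev FreeAlg : Type (max u v w) := MonoidAlgebra R (FreeSemigroup Λ.Gen)

/-- A generator, as an element of the free algebra. -/
noncomputable def gen (x : Λ.Gen) : Λ.FreeAlg R := MonoidAlgebra.single (FreeSemigroup.of x) 1

/-- The element of the free algebra given by a vertex. -/
noncomputable def freeP (v : C) : Λ.FreeAlg R := Λ.gen R (.vertex v)

open Classical in
/-- The element of the free algebra given by a path, with the convention that a path of degree zero
stands for the corresponding vertex. -/
noncomputable def freeS (l : KPath C) : Λ.FreeAlg R :=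
  if h : Λ.deg l = 0 then Λ.freeP R l.range else Λ.gen R (.path l h)

open Classical in
/-- The element of the free algebra given by the ghost of a path, with the convention that the ghost
of a path of degree zero stands for the corresponding vertex. -/
noncomputable def freeT (l : KPath C) : Λ.FreeAlg R :=
  if h : Λ.deg l = 0 then Λ.freeP R l.range else Λ.gen R (.ghost l h)

/-- The finite set `v Λ^n` of paths of degree `n` with range `v`. -/
noncomputable def pathsInto [Λ.RowFinite] (v : C) (n : Fin k → ℕ) : Finset (KPath C) :=
  (RowFinite.finite (Λ := Λ) v n).toFinset

/-- The defining relations of a Kumjian-Pask family, as a relation on the free algebra. -/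
inductive Rel [Λ.RowFinite] : Λ.FreeAlg R → Λ.FreeAlg R → Prop
  | kp1_self (v : C) : Rel (Λ.freeP R v * Λ.freeP R v) (Λ.freeP R v)
  | kp1_ne (v w : C) (h : v ≠ w) : Rel (Λ.freeP R v * Λ.freeP R w) 0
  | kp2_path {a b c : C} (l : b ⟶ c) (m : a ⟶ b) (hl : Λ.degree l ≠ 0) (hm : Λ.degree m ≠ 0) :
      Rel (Λ.freeS R ⟨l⟩ * Λ.freeS R ⟨m⟩) (Λ.freeS R ⟨m ≫ l⟩)
  | kp2_ghost {a b c : C} (l : b ⟶ c) (m : a ⟶ b) (hl : Λ.degree l ≠ 0) (hm : Λ.degree m ≠ 0) :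
      Rel (Λ.freeT R ⟨m⟩ * Λ.freeT R ⟨l⟩) (Λ.freeT R ⟨m ≫ l⟩)
  | kp2_range_path (l : KPath C) (hl : Λ.deg l ≠ 0) :
      Rel (Λ.freeP R l.range * Λ.freeS R l) (Λ.freeS R l)
  | kp2_path_source (l : KPath C) (hl : Λ.deg l ≠ 0) :
      Rel (Λ.freeS R l * Λ.freeP R l.source) (Λ.freeS R l)
  | kp2_source_ghost (l : KPath C) (hl : Λ.deg l ≠ 0) :
      Rel (Λ.freeP R l.source * Λ.freeT R l) (Λ.freeT R l)
  | kp2_ghost_range (l : KPath C) (hl : Λ.deg l ≠ 0) :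
      Rel (Λ.freeT R l * Λ.freeP R l.range) (Λ.freeT R l)
  | kp3_self (l : KPath C) (hl : Λ.deg l ≠ 0) :
      Rel (Λ.freeT R l * Λ.freeS R l) (Λ.freeP R l.source)
  | kp3_ne (l m : KPath C) (hl : Λ.deg l ≠ 0) (h : Λ.deg l = Λ.deg m) (hne : l ≠ m) :
      Rel (Λ.freeT R l * Λ.freeS R m) 0
  | kp4 (v : C) (n : Fin k → ℕ) (hn : n ≠ 0) :
      Rel (Λ.freeP R v) (∑ l ∈ Λ.pathsInto v n, Λ.freeS R l * Λ.freeT R l)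

/-- The algebra ideal (closed under scalars, since all scalar multiples of the generators are
included) of the free algebra generated by the Kumjian-Pask relations. -/
noncomputable def kpIdeal [Λ.RowFinite] : TwoSidedIdeal (Λ.FreeAlg R) :=
  TwoSidedIdeal.span {x | ∃ (r : R) (a b : Λ.FreeAlg R), Λ.Rel R a b ∧ x = r • (a - b)}

theorem smul_mem_kpIdeal [Λ.RowFinite] (r : R) {x : Λ.FreeAlg R} (hx : x ∈ Λ.kpIdeal R) :
    r • x ∈ Λ.kpIdeal R := by
  unfold kpIdeal at hx ⊢
  induction hx using TwoSidedIdeal.span_induction with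
  | mem x h =>
    obtain ⟨r', a, b, hab, rfl⟩ := h
    exact TwoSidedIdeal.subset_span ⟨r * r', a, b, hab, by rw [smul_smul]⟩
  | zero => rw [smul_zero]; exact TwoSidedIdeal.zero_mem _
  | add x y _ _ hx hy => rw [smul_add]; exact TwoSidedIdeal.add_mem _ hx hy
  | neg x _ hx => rw [smul_neg]; exact TwoSidedIdeal.neg_mem _ hx
  | left_absorb a x _ hx => rw [← mul_smul_comm]; exact TwoSidedIdeal.mul_mem_left _ _ _ hx
  | right_absorb b x _ hx => rw [← smul_mul_assoc]; exact TwoSidedIdeal.mul_mem_right _ _ _ hx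

variable [Λ.RowFinite]

/-- The Kumjian-Pask algebra of `Λ` over `R`: the quotient of the free `R`-algebra by the ideal
generated by the Kumjian-Pask relations. -/
def KP : Type (max u v w) := (Λ.kpIdeal R).ringCon.Quotient

noncomputable instance : NonUnitalRing (Λ.KP R) :=
  inferInstanceAs (NonUnitalRing (Λ.kpIdeal R).ringCon.Quotient)

/-- The quotient map from the free algebra onto the Kumjian-Pask algebra. -/
noncomputable def toKP : Λ.FreeAlg R →ₙ+* Λ.KP R where
  toFun x := (x : (Λ.kpIdeal R).ringCon.Quotient)
  map_mul' _ _ := rfl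
  map_zero' := rfl
  map_add' _ _ := rfl

theorem toKP_surjective : Function.Surjective (Λ.toKP R) := Quotient.mk_surjective

theorem toKP_eq_iff (x y : Λ.FreeAlg R) : Λ.toKP R x = Λ.toKP R y ↔ x - y ∈ Λ.kpIdeal R :=
  (RingCon.eq _).trans (TwoSidedIdeal.rel_iff _ x y)

noncomputable instance : SMul R (Λ.KP R) where
  smul r := Quotient.map (fun x => r • x) fun x y h => by
    have h' := (TwoSidedIdeal.rel_iff _ x y).1 h
    refine (TwoSidedIdeal.rel_iff _ (r • x) (r • y)).2 ?_
    rw [← smul_sub]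
    exact Λ.smul_mem_kpIdeal R r h'

theorem toKP_smul (r : R) (x : Λ.FreeAlg R) : Λ.toKP R (r • x) = r • Λ.toKP R x := rfl

noncomputable instance : Module R (Λ.KP R) :=
  Function.Surjective.module R (Λ.toKP R : Λ.FreeAlg R →+ Λ.KP R) (Λ.toKP_surjective R)
    (Λ.toKP_smul R)

instance : IsScalarTower R (Λ.KP R) (Λ.KP R) where
  smul_assoc r x y := by
    obtain ⟨x, rfl⟩ := Λ.toKP_surjective R x
    obtain ⟨y, rfl⟩ := Λ.toKP_surjective R y
    simp only [smul_eq_mul, ← toKP_smul, ← map_mul, smul_mul_assoc]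

instance : SMulCommClass R (Λ.KP R) (Λ.KP R) where
  smul_comm r x y := by
    obtain ⟨x, rfl⟩ := Λ.toKP_surjective R x
    obtain ⟨y, rfl⟩ := Λ.toKP_surjective R y
    simp only [smul_eq_mul, ← toKP_smul, ← map_mul, mul_smul_comm]

/-- The vertex idempotent `p_v`. -/
noncomputable def p (v : C) : Λ.KP R := Λ.toKP R (Λ.freeP R v)

/-- The element `s_l` of the Kumjian-Pask algebra given by a path; it is `p_v` for `l = v`. -/
noncomputable def s (l : KPath C) : Λ.KP R := Λ.toKP R (Λ.freeS R l)

/-- The element `s_{l^*}` given by the ghost of a path; it is `p_v` for `l = v`. -/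
noncomputable def sStar (l : KPath C) : Λ.KP R := Λ.toKP R (Λ.freeT R l)

/-! Elementary consequences of the Kumjian-Pask relations, used below to see that the induction
map takes values in ideals. -/

theorem toKP_eq_of_rel {a b : Λ.FreeAlg R} (h : Λ.Rel R a b) : Λ.toKP R a = Λ.toKP R b :=
  (Λ.toKP_eq_iff R a b).2 (TwoSidedIdeal.subset_span ⟨1, a, b, h, (one_smul R _).symm⟩)

theorem s_of_deg_eq_zero {l : KPath C} (h : Λ.deg l = 0) : Λ.s R l = Λ.p R l.range := by
  simp only [s, p, freeS, dif_pos h]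

theorem sStar_of_deg_eq_zero {l : KPath C} (h : Λ.deg l = 0) : Λ.sStar R l = Λ.p R l.range := by
  simp only [sStar, p, freeT, dif_pos h]

theorem s_id (v : C) : Λ.s R ⟨𝟙 v⟩ = Λ.p R v := Λ.s_of_deg_eq_zero R (Λ.degree_id v)

theorem sStar_id (v : C) : Λ.sStar R ⟨𝟙 v⟩ = Λ.p R v := Λ.sStar_of_deg_eq_zero R (Λ.degree_id v)

theorem p_mul_self (v : C) : Λ.p R v * Λ.p R v = Λ.p R v := by
  simpa only [p, s, sStar, map_mul] using Λ.toKP_eq_of_rel R (.kp1_self v)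

theorem p_mul_of_ne {v w : C} (h : v ≠ w) : Λ.p R v * Λ.p R w = 0 := by
  simpa only [p, s, sStar, map_mul, map_zero] using Λ.toKP_eq_of_rel R (.kp1_ne v w h)

theorem p_mul_s (l : KPath C) : Λ.p R l.range * Λ.s R l = Λ.s R l := by
  by_cases h : Λ.deg l = 0
  · rw [s_of_deg_eq_zero _ _ h, p_mul_self]
  · simpa only [p, s, sStar, map_mul] using Λ.toKP_eq_of_rel R (.kp2_range_path l h)

theorem s_mul_p (l : KPath C) : Λ.s R l * Λ.p R l.source = Λ.s R l := by
  by_cases h : Λ.deg l = 0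
  · rw [Λ.eq_id_of_deg_eq_zero h, s_id, p_mul_self]
  · simpa only [p, s, sStar, map_mul] using Λ.toKP_eq_of_rel R (.kp2_path_source l h)

theorem p_mul_sStar (l : KPath C) : Λ.p R l.source * Λ.sStar R l = Λ.sStar R l := by
  by_cases h : Λ.deg l = 0
  · rw [Λ.eq_id_of_deg_eq_zero h, sStar_id, p_mul_self]
  · simpa only [p, s, sStar, map_mul] using Λ.toKP_eq_of_rel R (.kp2_source_ghost l h)

theorem sStar_mul_p (l : KPath C) : Λ.sStar R l * Λ.p R l.range = Λ.sStar R l := by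
  by_cases h : Λ.deg l = 0
  · rw [sStar_of_deg_eq_zero _ _ h, p_mul_self]
  · simpa only [p, s, sStar, map_mul] using Λ.toKP_eq_of_rel R (.kp2_ghost_range l h)

theorem s_mul_s {a b c : C} (l : b ⟶ c) (m : a ⟶ b) :
    Λ.s R ⟨l⟩ * Λ.s R ⟨m⟩ = Λ.s R ⟨m ≫ l⟩ := by
  by_cases hl : Λ.degree l = 0
  · have h := Λ.eq_id_of_deg_eq_zero (l := ⟨l⟩) hl
    obtain rfl : b = c := congrArg KPath.source h
    obtain rfl : l = 𝟙 b := eq_of_heq (KPath.mk.inj h).2.2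
    rw [Category.comp_id, s_id]
    exact Λ.p_mul_s R ⟨m⟩
  by_cases hm : Λ.degree m = 0
  · have h := Λ.eq_id_of_deg_eq_zero (l := ⟨m⟩) hm
    obtain rfl : a = b := congrArg KPath.source h
    obtain rfl : m = 𝟙 a := eq_of_heq (KPath.mk.inj h).2.2
    rw [Category.id_comp, s_id]
    exact Λ.s_mul_p R ⟨l⟩
  simpa only [p, s, sStar, map_mul] using Λ.toKP_eq_of_rel R (.kp2_path l m hl hm)

theorem sStar_mul_sStar {a b c : C} (l : b ⟶ c) (m : a ⟶ b) :
    Λ.sStar R ⟨m⟩ * Λ.sStar R ⟨l⟩ = Λ.sStar R ⟨m ≫ l⟩ := by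
  by_cases hl : Λ.degree l = 0
  · have h := Λ.eq_id_of_deg_eq_zero (l := ⟨l⟩) hl
    obtain rfl : b = c := congrArg KPath.source h
    obtain rfl : l = 𝟙 b := eq_of_heq (KPath.mk.inj h).2.2
    rw [Category.comp_id, sStar_id]
    exact Λ.sStar_mul_p R ⟨m⟩
  by_cases hm : Λ.degree m = 0
  · have h := Λ.eq_id_of_deg_eq_zero (l := ⟨m⟩) hm
    obtain rfl : a = b := congrArg KPath.source h
    obtain rfl : m = 𝟙 a := eq_of_heq (KPath.mk.inj h).2.2
    rw [Category.id_comp, sStar_id]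
    exact Λ.p_mul_sStar R ⟨l⟩
  simpa only [p, s, sStar, map_mul] using Λ.toKP_eq_of_rel R (.kp2_ghost l m hl hm)

theorem sStar_mul_s_self (l : KPath C) : Λ.sStar R l * Λ.s R l = Λ.p R l.source := by
  by_cases h : Λ.deg l = 0
  · rw [Λ.eq_id_of_deg_eq_zero h, sStar_id, s_id, p_mul_self]
  · simpa only [p, s, sStar, map_mul] using Λ.toKP_eq_of_rel R (.kp3_self l h)

theorem sStar_mul_s_of_ne {l m : KPath C} (h : Λ.deg l = Λ.deg m) (hne : l ≠ m) :
    Λ.sStar R l * Λ.s R m = 0 := by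
  by_cases hl : Λ.deg l = 0
  · have hm : Λ.deg m = 0 := h ▸ hl
    rw [sStar_of_deg_eq_zero _ _ hl, s_of_deg_eq_zero _ _ hm]
    refine Λ.p_mul_of_ne R fun he => hne ?_
    rw [Λ.eq_id_of_deg_eq_zero hl, Λ.eq_id_of_deg_eq_zero hm, he]
  · simpa only [p, s, sStar, map_mul, map_zero] using Λ.toKP_eq_of_rel R (.kp3_ne l m hl h hne)

theorem p_eq_sum (v : C) (n : Fin k → ℕ) :
    Λ.p R v = ∑ l ∈ Λ.pathsInto v n, Λ.s R l * Λ.sStar R l := by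
  by_cases hn : n = 0
  · have h : Λ.pathsInto v n = {⟨𝟙 v⟩} := by
      ext l
      simp only [pathsInto, Set.Finite.mem_toFinset, Set.mem_ofPred_eq, Finset.mem_singleton]
      constructor
      · rintro ⟨rfl, hl⟩
        exact Λ.eq_id_of_deg_eq_zero (hl.trans hn)
      · rintro rfl
        exact ⟨rfl, hn ▸ Λ.degree_id v⟩
    rw [h, Finset.sum_singleton, s_id, sStar_id, p_mul_self]
  · simpa only [p, s, sStar, map_mul, map_sum] using Λ.toKP_eq_of_rel R (.kp4 v n hn)

theorem s_mul_s_or (l m : KPath C) :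
    Λ.s R l * Λ.s R m = 0 ∨ ∃ d, Λ.s R l * Λ.s R m = Λ.s R d := by
  obtain ⟨l⟩ := l
  obtain ⟨m⟩ := m
  rename_i b c a b'
  by_cases h : b = b'
  · subst h
    exact .inr ⟨_, Λ.s_mul_s R l m⟩
  · left
    rw [← Λ.s_mul_p R ⟨l⟩, ← Λ.p_mul_s R ⟨m⟩, mul_assoc, ← mul_assoc (Λ.p R _),
      Λ.p_mul_of_ne R h, zero_mul, mul_zero]

theorem sStar_mul_sStar_or (m l : KPath C) :
    Λ.sStar R m * Λ.sStar R l = 0 ∨ ∃ d, Λ.sStar R m * Λ.sStar R l = Λ.sStar R d := by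
  obtain ⟨m⟩ := m
  obtain ⟨l⟩ := l
  rename_i a b' b c
  by_cases h : b' = b
  · subst h
    exact .inr ⟨_, Λ.sStar_mul_sStar R l m⟩
  · left
    rw [← Λ.sStar_mul_p R ⟨m⟩, ← Λ.p_mul_sStar R ⟨l⟩, mul_assoc, ← mul_assoc (Λ.p R _),
      Λ.p_mul_of_ne R h, zero_mul, mul_zero]

theorem sStar_mul_s_or {l m : KPath C} (h : Λ.deg l ≤ Λ.deg m) :
    Λ.sStar R l * Λ.s R m = 0 ∨ ∃ d, Λ.sStar R l * Λ.s R m = Λ.s R d := by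
  obtain ⟨c, f, g, hf, hg⟩ := Λ.exists_factor m (Λ.deg l) h
  have hm : Λ.s R m = Λ.s R ⟨f⟩ * Λ.s R ⟨g⟩ := by rw [s_mul_s, hg]
  rw [hm, ← mul_assoc]
  by_cases hl : l = ⟨f⟩
  · right
    refine ⟨⟨g⟩, ?_⟩
    rw [hl, sStar_mul_s_self]
    exact Λ.p_mul_s R ⟨g⟩
  · left
    rw [Λ.sStar_mul_s_of_ne R hf.symm hl, zero_mul]

theorem sStar_mul_s_or' {l m : KPath C} (h : Λ.deg l ≤ Λ.deg m) :
    Λ.sStar R m * Λ.s R l = 0 ∨ ∃ d, Λ.sStar R m * Λ.s R l = Λ.sStar R d := by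
  obtain ⟨c, f, g, hf, hg⟩ := Λ.exists_factor m (Λ.deg l) h
  have hm : Λ.sStar R m = Λ.sStar R ⟨g⟩ * Λ.sStar R ⟨f⟩ := by rw [sStar_mul_sStar, hg]
  rw [hm, mul_assoc]
  by_cases hl : (⟨f⟩ : KPath C) = l
  · right
    refine ⟨⟨g⟩, ?_⟩
    rw [← hl, sStar_mul_s_self]
    exact Λ.sStar_mul_p R ⟨g⟩
  · left
    rw [Λ.sStar_mul_s_of_ne R (l := ⟨f⟩) hf hl, mul_zero]

/-- The Kumjian-Pask algebra is generated by the elements `s_l` and `s_{l^*}`. -/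
theorem kp_induction {P : Λ.KP R → Prop} (hs : ∀ l, P (Λ.s R l)) (ht : ∀ l, P (Λ.sStar R l))
    (zero : P 0) (add : ∀ x y, P x → P y → P (x + y)) (mul : ∀ x y, P x → P y → P (x * y))
    (smul : ∀ (r : R) x, P x → P (r • x)) (x : Λ.KP R) : P x := by
  obtain ⟨x, rfl⟩ := Λ.toKP_surjective R x
  induction x using MonoidAlgebra.induction_linear with
  | zero => rwa [map_zero]
  | add f g hf hg => rw [map_add]; exact add _ _ hf hg
  | single w r =>
    have hw : ∀ w : FreeSemigroup Λ.Gen, P (Λ.toKP R (MonoidAlgebra.single w 1)) := by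
      intro w
      induction w using FreeSemigroup.recOnMul with
      | ih1 x =>
        cases x with
        | vertex v =>
          have h := hs ⟨𝟙 v⟩
          rw [s_id] at h
          exact h
        | path l h => simpa only [s, freeS, dif_neg h, gen] using hs l
        | ghost l h => simpa only [sStar, freeT, dif_neg h, gen] using ht l
      | ih2 x y hx hy =>
        have h : (MonoidAlgebra.single (FreeSemigroup.of x * y) 1 : Λ.FreeAlg R) =
            MonoidAlgebra.single (FreeSemigroup.of x) 1 * MonoidAlgebra.single y 1 := by
          rw [MonoidAlgebra.single_mul_single, one_mul]
        rw [h, map_mul]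
        exact mul _ _ hx hy
    have h : (MonoidAlgebra.single w r : Λ.FreeAlg R) = r • MonoidAlgebra.single w 1 := by
      rw [MonoidAlgebra.smul_single, smul_eq_mul, mul_one]
    rw [h, toKP_smul]
    exact smul _ _ (hw w)

/-- The `R`-linear span of the elements `r s_l s_{m^*}` with `r ∈ M`. -/
noncomputable def indSpan (M : Ideal R) : Submodule R (Λ.KP R) :=
  Submodule.span R {x | ∃ r ∈ M, ∃ l m : KPath C, x = r • (Λ.s R l * Λ.sStar R m)}

variable {R}

theorem mem_indSpan {M : Ideal R} {r : R} (hr : r ∈ M) (l m : KPath C) :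
    r • (Λ.s R l * Λ.sStar R m) ∈ Λ.indSpan R M :=
  Submodule.subset_span ⟨r, hr, l, m, rfl⟩

/-- Since `s_l s_{m^*}` is a sum of elements `s_{l'} s_{m'^*}` with `d(l'), d(m') ≥ n`, a linear map
sends `r s_l s_{m^*}` into `W` as soon as it does so for these. -/
theorem map_smul_s_mul_sStar_mem (W : Submodule R (Λ.KP R)) (F : Λ.KP R →+ Λ.KP R)
    (hF : ∀ (r : R) x, F (r • x) = r • F x) (n : Fin k → ℕ) (r : R)
    (h : ∀ l m : KPath C, n ≤ Λ.deg l → n ≤ Λ.deg m → r • F (Λ.s R l * Λ.sStar R m) ∈ W)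
    (l m : KPath C) : F (r • (Λ.s R l * Λ.sStar R m)) ∈ W := by
  obtain ⟨l⟩ := l
  obtain ⟨m⟩ := m
  rename_i a b a' c
  by_cases ha : a = a'
  · subst ha
    have hsum : Λ.s R ⟨l⟩ * Λ.sStar R ⟨m⟩ =
        ∑ g ∈ Λ.pathsInto a n, Λ.s R ⟨l⟩ * Λ.s R g * (Λ.sStar R g * Λ.sStar R ⟨m⟩) := by
      conv_lhs => rw [← Λ.s_mul_p R ⟨l⟩]
      rw [Λ.p_eq_sum R _ n, Finset.mul_sum, Finset.sum_mul]
      exact Finset.sum_congr rfl fun g _ => by simp only [mul_assoc]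
    rw [hsum, hF, map_sum, Finset.smul_sum]
    refine Submodule.sum_mem _ fun g hg => ?_
    obtain ⟨g⟩ := g
    simp only [pathsInto, Set.Finite.mem_toFinset, Set.mem_ofPred_eq] at hg
    obtain ⟨rfl, hg⟩ := hg
    have hg' : Λ.degree g = n := hg
    rw [s_mul_s, sStar_mul_sStar]
    refine h _ _ ?_ ?_
    · simp only [deg, Λ.degree_comp, hg']; exact le_self_add
    · simp only [deg, Λ.degree_comp, hg']; exact le_self_add
  · have : Λ.s R ⟨l⟩ * Λ.sStar R ⟨m⟩ = 0 := by
      rw [← Λ.s_mul_p R ⟨l⟩, ← Λ.p_mul_sStar R ⟨m⟩, mul_assoc, ← mul_assoc (Λ.p R _),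
        Λ.p_mul_of_ne R ha, zero_mul, mul_zero]
    rw [this, smul_zero, map_zero]
    exact W.zero_mem

theorem mul_mem_indSpan_left {M : Ideal R} (y : Λ.KP R) {x : Λ.KP R} (hx : x ∈ Λ.indSpan R M) :
    y * x ∈ Λ.indSpan R M := by
  induction y using Λ.kp_induction R generalizing x with
  | zero => rw [zero_mul]; exact Submodule.zero_mem _
  | add a b ha hb => rw [add_mul]; exact Submodule.add_mem _ (ha hx) (hb hx)
  | mul a b ha hb => rw [mul_assoc]; exact ha (hb hx)
  | smul r a ha => rw [smul_mul_assoc]; exact Submodule.smul_mem _ _ (ha hx)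
  | hs d =>
    unfold indSpan at hx
    induction hx using Submodule.span_induction with
    | zero => rw [mul_zero]; exact Submodule.zero_mem _
    | add a b _ _ ha hb => rw [mul_add]; exact Submodule.add_mem _ ha hb
    | smul r a _ ha => rw [mul_smul_comm]; exact Submodule.smul_mem _ _ ha
    | mem x h =>
      obtain ⟨r, hr, l, m, rfl⟩ := h
      rw [mul_smul_comm, ← mul_assoc]
      obtain h | ⟨e, h⟩ := Λ.s_mul_s_or R d l
      · rw [h, zero_mul, smul_zero]; exact Submodule.zero_mem _
      · rw [h]; exact Λ.mem_indSpan hr _ _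
  | ht d =>
    unfold indSpan at hx
    induction hx using Submodule.span_induction with
    | zero => rw [mul_zero]; exact Submodule.zero_mem _
    | add a b _ _ ha hb => rw [mul_add]; exact Submodule.add_mem _ ha hb
    | smul r a _ ha => rw [mul_smul_comm]; exact Submodule.smul_mem _ _ ha
    | mem x h =>
      obtain ⟨r, hr, l, m, rfl⟩ := h
      refine Λ.map_smul_s_mul_sStar_mem _ (AddMonoidHom.mulLeft (Λ.sStar R d))
        (fun r x => mul_smul_comm r _ x) (Λ.deg d) r (fun l m hl _ => ?_) l m
      rw [AddMonoidHom.coe_mulLeft, ← mul_assoc]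
      obtain h | ⟨e, h⟩ := Λ.sStar_mul_s_or R hl
      · rw [h, zero_mul, smul_zero]; exact Submodule.zero_mem _
      · rw [h]; exact Λ.mem_indSpan hr _ _

theorem mul_mem_indSpan_right {M : Ideal R} (y : Λ.KP R) {x : Λ.KP R} (hx : x ∈ Λ.indSpan R M) :
    x * y ∈ Λ.indSpan R M := by
  induction y using Λ.kp_induction R generalizing x with
  | zero => rw [mul_zero]; exact Submodule.zero_mem _
  | add a b ha hb => rw [mul_add]; exact Submodule.add_mem _ (ha hx) (hb hx)
  | mul a b ha hb => rw [← mul_assoc]; exact hb (ha hx)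
  | smul r a ha => rw [mul_smul_comm]; exact Submodule.smul_mem _ _ (ha hx)
  | ht d =>
    unfold indSpan at hx
    induction hx using Submodule.span_induction with
    | zero => rw [zero_mul]; exact Submodule.zero_mem _
    | add a b _ _ ha hb => rw [add_mul]; exact Submodule.add_mem _ ha hb
    | smul r a _ ha => rw [smul_mul_assoc]; exact Submodule.smul_mem _ _ ha
    | mem x h =>
      obtain ⟨r, hr, l, m, rfl⟩ := h
      rw [smul_mul_assoc, mul_assoc]
      obtain h | ⟨e, h⟩ := Λ.sStar_mul_sStar_or R m d
      · rw [h, mul_zero, smul_zero]; exact Submodule.zero_mem _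
      · rw [h]; exact Λ.mem_indSpan hr _ _
  | hs d =>
    unfold indSpan at hx
    induction hx using Submodule.span_induction with
    | zero => rw [zero_mul]; exact Submodule.zero_mem _
    | add a b _ _ ha hb => rw [add_mul]; exact Submodule.add_mem _ ha hb
    | smul r a _ ha => rw [smul_mul_assoc]; exact Submodule.smul_mem _ _ ha
    | mem x h =>
      obtain ⟨r, hr, l, m, rfl⟩ := h
      refine Λ.map_smul_s_mul_sStar_mem _ (AddMonoidHom.mulRight (Λ.s R d))
        (fun r x => smul_mul_assoc r x _) (Λ.deg d) r (fun l m _ hm => ?_) l m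
      change r • (Λ.s R l * Λ.sStar R m * Λ.s R d) ∈ _
      rw [mul_assoc]
      obtain h | ⟨e, h⟩ := Λ.sStar_mul_s_or' R hm
      · rw [h, mul_zero, smul_zero]; exact Submodule.zero_mem _
      · rw [h]; exact Λ.mem_indSpan hr _ _

variable (R)

/-- The induction map: `Ind M` is the `R`-linear span of `{r s_l s_{m^*} : r ∈ M}`, which is a
two-sided ideal of the ring `KP_R(Λ)`. -/
noncomputable def Ind (M : Ideal R) : TwoSidedIdeal (Λ.KP R) :=
  TwoSidedIdeal.mk' (Λ.indSpan R M) (Submodule.zero_mem _) (Submodule.add_mem _)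
    (Submodule.neg_mem _) (Λ.mul_mem_indSpan_left _) (Λ.mul_mem_indSpan_right _)

/-- The restriction map: `Res I = {r ∈ R : r p_v ∈ I for all v}`, for a two-sided ideal `I` of the
ring `KP_R(Λ)`. -/
noncomputable def Res (I : TwoSidedIdeal (Λ.KP R)) : Ideal R where
  carrier := {r | ∀ v : C, r • Λ.p R v ∈ I}
  zero_mem' v := by rw [zero_smul]; exact I.zero_mem
  add_mem' ha hb v := by rw [add_smul]; exact I.add_mem (ha v) (hb v)
  smul_mem' c r hr v := by
    have h : (c • r) • Λ.p R v = (c • Λ.p R v) * (r • Λ.p R v) := by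
      rw [smul_mul_assoc, mul_smul_comm, p_mul_self, smul_smul, smul_eq_mul]
    rw [h]
    exact I.mul_mem_left _ _ (hr v)

end KumjianPask

end KGraph

/-! The inclusions `M ≤ Res (Ind M)` and `Ind (Res I) ≤ I` are formal. Everything else rests on
representations that show elements to be nonzero, and on a compression argument that extracts
multiples of vertex idempotents from an ideal.

Representations. Let the paths act on a set by partial injections so that, for each degree, every
point factors uniquely through a path of that degree. Functions on such a set, with values in an
`R`-module, carry a representation of the Kumjian–Pask algebra: `s_l` transports a function along `y
↦ l y` and is zero off the image, while the ghost pulls it back. Infinite paths form such a set,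
which is nonempty because there are no sources. With values in `R ⧸ M` the ideal `Ind M` acts by
zero, but `r p_v` acts as `r` at an infinite path of range `v`; hence `Res (Ind M) = M`.

Aperiodic and cofinal implies `Ind ∘ Res = id`. Write an element of `I` outside `Ind M` as a
combination of products `s_α s_{β^*}` whose ghosts all have the same degree. Some coefficient `r`
lies outside `M`, and aperiodicity supplies a compression that kills all other terms, so that `r p_v
∈ I` for some `v`. For fixed `r`, the vertices with `r p_v ∈ I` form a hereditary and saturated set;
cofinality makes it everything once it is nonempty, so `r ∈ Res I`. Taking `M = Res I` gives a
contradiction.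

Converse. If `Ind ∘ Res = id`, the kernel of a representation over `R` on a nonempty set has
restriction zero, so the representation is faithful. If cofinality fails at `x` and `v`, the
infinite paths none of whose vertices connects to `v` form an invariant nonempty set on which `p_v`
acts by zero, although `p_v ≠ 0`. If aperiodicity fails, there are `α`, `β` of different degrees
with `α y = β y` for all infinite paths `y`; faithfulness gives `s_α = s_β`. The product of the
infinite paths with `ℤ ^ k`, which records degrees, separates `s_α` from `s_β`. -/

/-! ### Total composition of paths and the prefix order, free of dependent types -/

namespace KPath

variable {C : Type u} [Category.{v} C]

open Classical in
/-- The composite path `fg` when `s(f) = r(g)`, and `f` otherwise. -/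
noncomputable def cat (f g : KPath C) : KPath C :=
  if h : g.range = f.source then ⟨g.hom ≫ eqToHom h ≫ f.hom⟩ else f

theorem cat_mk {a b c : C} (f : b ⟶ c) (g : a ⟶ b) :
    cat (⟨f⟩ : KPath C) ⟨g⟩ = ⟨g ≫ f⟩ := by
  simp [cat]

theorem cat_range (f g : KPath C) : (cat f g).range = f.range := by
  unfold cat; split_ifs <;> rfl

theorem cat_source {f g : KPath C} (h : g.range = f.source) : (cat f g).source = g.source := by
  unfold cat; rw [dif_pos h]

theorem cat_assoc {f g h : KPath C} (h₁ : g.range = f.source) (h₂ : h.range = g.source) :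
    cat (cat f g) h = cat f (cat g h) := by
  obtain ⟨f⟩ := f; obtain ⟨g⟩ := g; obtain ⟨h⟩ := h
  dsimp only at h₁ h₂
  subst h₁ h₂
  simp [cat_mk]

theorem cat_id (f : KPath C) : cat f ⟨𝟙 f.source⟩ = f := by
  obtain ⟨f⟩ := f
  simp [cat_mk]

theorem id_cat (f : KPath C) : cat ⟨𝟙 f.range⟩ f = f := by
  obtain ⟨f⟩ := f
  simp [cat_mk]

/-- `a` is an initial segment of `b`. -/
def IsPrefix (a b : KPath C) : Prop := ∃ g : KPath C, g.range = a.source ∧ cat a g = b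

theorem IsPrefix.refl (a : KPath C) : IsPrefix a a := ⟨_, rfl, cat_id a⟩

theorem IsPrefix.trans {a b c : KPath C} (h₁ : IsPrefix a b) (h₂ : IsPrefix b c) :
    IsPrefix a c := by
  obtain ⟨g, hg, rfl⟩ := h₁
  obtain ⟨g', hg', rfl⟩ := h₂
  rw [cat_source hg] at hg'
  exact ⟨cat g g', by rw [cat_range, hg], (cat_assoc hg hg').symm⟩

theorem IsPrefix.range_eq {a b : KPath C} (h : IsPrefix a b) : a.range = b.range := by
  obtain ⟨g, -, rfl⟩ := h
  rw [cat_range]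

theorem isPrefix_cat {a g : KPath C} (h : g.range = a.source) : IsPrefix a (cat a g) :=
  ⟨g, h, rfl⟩

theorem IsPrefix.cat_left {f a b : KPath C} (hf : a.range = f.source) (h : IsPrefix a b) :
    IsPrefix (cat f a) (cat f b) := by
  obtain ⟨g, hg, rfl⟩ := h
  exact ⟨g, by rw [cat_source hf, hg], cat_assoc hf hg⟩

end KPath

/-! ### Unique factorization, and what the failure of aperiodicity provides -/

namespace KGraph

open KPath

variable {k : ℕ} {C : Type u} [Category.{v} C] (Λ : KGraph k C)

theorem deg_cat {f g : KPath C} (h : g.range = f.source) :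
    Λ.deg (cat f g) = Λ.deg f + Λ.deg g := by
  obtain ⟨f⟩ := f; obtain ⟨g⟩ := g
  dsimp only at h
  subst h
  rw [cat_mk]
  exact (Λ.degree_comp _ _).trans (add_comm _ _)

theorem exists_cat (l : KPath C) {n : Fin k → ℕ} (h : n ≤ Λ.deg l) :
    ∃ f g : KPath C, g.range = f.source ∧ Λ.deg f = n ∧ cat f g = l := by
  obtain ⟨c, f, g, hf, hg⟩ := Λ.exists_factor l n h
  exact ⟨⟨f⟩, ⟨g⟩, rfl, hf, by rw [cat_mk, hg]⟩

theorem cat_inj {f g f' g' : KPath C} (h : g.range = f.source) (h' : g'.range = f'.source)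
    (hd : Λ.deg f = Λ.deg f') (he : cat f g = cat f' g') : f = f' ∧ g = g' := by
  have hdg : Λ.deg g = Λ.deg g' := by
    have := congrArg Λ.deg he
    rw [Λ.deg_cat h, Λ.deg_cat h', hd] at this
    exact add_left_cancel this
  obtain ⟨f⟩ := f; obtain ⟨g⟩ := g; obtain ⟨f'⟩ := f'; obtain ⟨g'⟩ := g'
  rename_i a b a₁ b₁ a' b' a₁' b₁'
  dsimp only at h h'
  subst h h'
  rw [cat_mk, cat_mk] at he
  obtain rfl : a₁ = a₁' := congrArg KPath.source he
  obtain rfl : b = b' := congrArg KPath.range he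
  have he' : g ≫ f = g' ≫ f' := eq_of_heq (KPath.mk.inj he).2.2
  have := (Λ.factorization (g ≫ f) (Λ.degree f) (Λ.degree g)
    ((Λ.degree_comp _ _).trans (add_comm _ _))).unique
    (y₁ := ⟨_, g, f⟩) (y₂ := ⟨_, g', f'⟩) ⟨rfl, rfl, rfl⟩ ⟨hd.symm, hdg.symm, he'.symm⟩
  cases this
  exact ⟨rfl, rfl⟩

theorem eq_of_isPrefix {a b c : KPath C} (ha : IsPrefix a c) (hb : IsPrefix b c)
    (h : Λ.deg a = Λ.deg b) : a = b := by
  obtain ⟨g, hg, rfl⟩ := ha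
  obtain ⟨g', hg', he⟩ := hb
  exact (Λ.cat_inj hg hg' h he.symm).1

theorem exists_isPrefix (l : KPath C) {n : Fin k → ℕ} (h : n ≤ Λ.deg l) :
    ∃ a, IsPrefix a l ∧ Λ.deg a = n := by
  obtain ⟨f, g, hg, hf, rfl⟩ := Λ.exists_cat l h
  exact ⟨f, isPrefix_cat hg, hf⟩

theorem isPrefix_of_deg_le {a b c : KPath C} (ha : IsPrefix a c) (hb : IsPrefix b c)
    (h : Λ.deg a ≤ Λ.deg b) : IsPrefix a b := by
  obtain ⟨a', ha', hd⟩ := Λ.exists_isPrefix b h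
  rwa [Λ.eq_of_isPrefix ha (ha'.trans hb) hd.symm]

theorem isPrefix_of_cat {k : ℕ} (Λ : KGraph k C) {f a b : KPath C}
    (ha : a.range = f.source) (hb : b.range = f.source)
    (h : IsPrefix (cat f a) (cat f b)) : IsPrefix a b := by
  obtain ⟨g, hg, he⟩ := h
  rw [cat_source ha] at hg
  rw [cat_assoc ha hg] at he
  exact ⟨g, hg, (Λ.cat_inj (by rw [cat_range, ha]) hb rfl he).2⟩

theorem isSegment_iff {l x : KPath C} {p q : Fin k → ℕ} :
    Λ.IsSegment l p q x ↔ p + Λ.deg x = q ∧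
      ∃ f : KPath C, x.range = f.source ∧ Λ.deg f = p ∧ IsPrefix (cat f x) l := by
  constructor
  · rintro ⟨f, g, hf, hx, he⟩
    obtain ⟨l⟩ := l
    obtain ⟨x⟩ := x
    refine ⟨hx, ⟨f⟩, rfl, hf, ⟨g⟩, ?_, ?_⟩
    · rw [cat_mk]
    · rw [cat_mk, cat_mk, he]
  · rintro ⟨hx, ⟨f⟩, h, hf, ⟨g⟩, hg, rfl⟩
    obtain ⟨x⟩ := x
    dsimp only at h
    subst h
    rw [cat_mk] at hg ⊢
    dsimp only at hg
    subst hg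
    rw [cat_mk]
    exact ⟨f, g, hf, hx, rfl⟩

/-- If aperiodicity fails at `v`, `m`, `n`, factor one path `ρ` of degree `m ⊔ n` as `ρ = μα = νβ`
with `d(μ) = m` and `d(ν) = n`. The segments of `ργ = μ(αγ) = ν(βγ)` starting at `m` and at `n` are
the initial segments of `αγ` and `βγ`, which therefore agree up to degree `d(γ)`. In the limit, `αy
= βy` for every infinite path `y`. -/
theorem exists_common_tails_of_not_aperiodic [Λ.NoSources] (h : ¬ Λ.Aperiodic) :
    ∃ α β : KPath C, α.source = β.source ∧ α.range = β.range ∧ Λ.deg α ≠ Λ.deg β ∧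
      ∀ γ x y : KPath C, γ.range = α.source → Λ.deg x = Λ.deg γ → Λ.deg y = Λ.deg γ →
        IsPrefix x (cat α γ) → IsPrefix y (cat β γ) → x = y := by
  unfold Aperiodic at h
  push Not at h
  obtain ⟨v, m, n, hmn, H⟩ := h
  obtain ⟨ρ, rfl, hρ⟩ := NoSources.exists_path (Λ := Λ) v (m ⊔ n)
  obtain ⟨μ, α, hα, hμ, rfl⟩ := Λ.exists_cat ρ (n := m) (by rw [hρ]; exact le_sup_left)
  obtain ⟨ν, β, hβ, hν, he⟩ := Λ.exists_cat (cat μ α) (n := n) (by rw [hρ]; exact le_sup_right)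
  have hs : α.source = β.source := by
    rw [← cat_source hα, ← he, cat_source hβ]
  have hr : α.range = β.range := by
    -- For `ρ` itself the two segments have degree zero, so they are the vertices `s(μ)` and `s(ν)`,
    -- the ranges of `α` and `β`.
    have := H (cat μ α) rfl hρ.ge ⟨𝟙 μ.source⟩ ⟨𝟙 ν.source⟩
      (Λ.isSegment_iff.2 ⟨by rw [hρ, tsub_self]; exact congrArg (m + ·) (Λ.degree_id _), μ, rfl,
        hμ, by rw [cat_id]; exact isPrefix_cat hα⟩)
      (Λ.isSegment_iff.2 ⟨by rw [hρ, tsub_self]; exact congrArg (n + ·) (Λ.degree_id _), ν, rfl,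
        hν, by rw [cat_id, ← he]; exact isPrefix_cat hβ⟩)
    rw [hα, hβ]
    exact (congrArg KPath.source this :)
  have hdα := Λ.deg_cat hα
  have hdβ := Λ.deg_cat hβ
  rw [hρ, hμ] at hdα
  rw [he, hρ, hν] at hdβ
  refine ⟨α, β, hs, hr, fun hd => hmn ?_, fun γ x y hγ hx hy hxp hyp => ?_⟩
  · rw [hdα, hd] at hdβ
    exact add_right_cancel hdβ
  have hγ' : γ.range = (cat μ α).source := by rw [cat_source hα, hγ]
  have hsub : Λ.deg (cat (cat μ α) γ) - m ⊔ n = Λ.deg γ := by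
    rw [Λ.deg_cat hγ', hρ, add_tsub_cancel_left]
  refine H (cat (cat μ α) γ) (cat_range _ _) (by rw [Λ.deg_cat hγ', hρ]; exact le_self_add) x y
    (Λ.isSegment_iff.2 ⟨by rw [hsub, hx], μ, ?_, hμ, ?_⟩)
    (Λ.isSegment_iff.2 ⟨by rw [hsub, hy], ν, ?_, hν, ?_⟩)
  · rw [hxp.range_eq, cat_range, hα]
  · rw [cat_assoc hα hγ]
    exact hxp.cat_left (by rw [hxp.range_eq, cat_range, hα])
  · rw [hyp.range_eq, cat_range, hβ]
  · rw [← he, cat_assoc hβ (hγ.trans hs)]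
    exact hyp.cat_left (by rw [hyp.range_eq, cat_range, hβ])

end KGraph

/-! ### Infinite paths and branching systems -/

namespace KGraph

open KPath

variable {k : ℕ} {C : Type u} [Category.{v} C] (Λ : KGraph k C)

/-- An infinite path, given by its initial segments `x n` of degree `n`. -/
structure IPath where
  toFun : (Fin k → ℕ) → KPath C
  deg_toFun : ∀ n, Λ.deg (toFun n) = n
  isPrefix : ∀ {m n}, m ≤ n → IsPrefix (toFun m) (toFun n)

namespace IPath

variable {Λ}

instance : CoeFun Λ.IPath (fun _ => (Fin k → ℕ) → KPath C) := ⟨toFun⟩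

/-- The range of an infinite path. -/
def rng (x : Λ.IPath) : C := (x 0).range

theorem range_apply (x : Λ.IPath) (n : Fin k → ℕ) : (x n).range = x.rng :=
  (x.isPrefix (m := 0) zero_le).range_eq.symm

theorem apply_zero (x : Λ.IPath) : x 0 = ⟨𝟙 x.rng⟩ := Λ.eq_id_of_deg_eq_zero (x.deg_toFun 0)

theorem ext_of_frequently {x y : Λ.IPath} (h : ∀ n, ∃ N, n ≤ N ∧ x N = y N) : x = y := by
  have : x.toFun = y.toFun := by
    funext n
    obtain ⟨N, hN, he⟩ := h n
    exact Λ.eq_of_isPrefix (x.isPrefix hN) (he ▸ y.isPrefix hN)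
      ((x.deg_toFun n).trans (y.deg_toFun n).symm)
  cases x; cases y; cases this; rfl

/-- The infinite path with initial segments the members of an increasing family of paths. -/
theorem exists_of_monotone (z : (Fin k → ℕ) → KPath C) (hz : ∀ n, n ≤ Λ.deg (z n))
    (hmono : ∀ m n, m ≤ n → IsPrefix (z m) (z n)) :
    ∃ x : Λ.IPath, ∀ n, x (Λ.deg (z n)) = z n := by
  choose a ha hd using fun n => Λ.exists_isPrefix (z n) (hz n)
  refine ⟨⟨a, hd, fun {m n} h => ?_⟩, fun n => ?_⟩
  · exact Λ.isPrefix_of_deg_le ((ha m).trans (hmono _ _ h)) (ha n) (by rwa [hd, hd])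
  · exact Λ.eq_of_isPrefix (ha _) (hmono _ _ (hz n)) (hd _)

/-- Iterating the hypothesis gives paths of degree `(j, …, j)`, each a prefix of the next, and these
are cofinal in `ℕ ^ k`. The property is controlled only at the diagonal vertices; for properties
that propagate along paths, as in `Cofinal.mem_Res`, this is enough. -/
theorem exists_forall_source {P : C → Prop}
    (hP : ∀ v, P v → ∃ l : KPath C, l.range = v ∧ Λ.deg l = 1 ∧ P l.source) {v : C} (hv : P v) :
    ∃ x : Λ.IPath, x.rng = v ∧ ∀ j : ℕ, P (x (fun _ => j)).source := by
  choose g hg hgd hgP using hP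
  let S : ℕ → {l : KPath C // P l.source} := fun j =>
    Nat.rec ⟨⟨𝟙 v⟩, hv⟩ (fun _ l => ⟨cat l.1 (g _ l.2), by
      rw [cat_source (hg _ _)]; exact hgP _ _⟩) j
  have hS : ∀ j, (S (j + 1)).1 = cat (S j).1 (g _ (S j).2) := fun j => rfl
  have hdeg : ∀ j, Λ.deg (S j).1 = fun _ => j := by
    intro j
    induction j with
    | zero => exact Λ.degree_id v
    | succ j ih => rw [hS, Λ.deg_cat (hg _ _), ih, hgd]; rfl
  have hmono : ∀ i j, i ≤ j → IsPrefix (S i).1 (S j).1 := by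
    intro i j hij
    induction hij with
    | refl => exact .refl _
    | step _ ih => exact ih.trans (hS _ ▸ isPrefix_cat (hg _ _))
  obtain ⟨x, hx⟩ := exists_of_monotone (Λ := Λ) (fun n => (S (Finset.univ.sup n)).1)
    (fun n => by rw [hdeg]; exact fun i => Finset.le_sup (Finset.mem_univ i))
    (fun m n h => hmono _ _ (Finset.sup_mono_fun fun i _ => h i))
  simp only [hdeg] at hx
  have hx1 : ∀ j, (x fun _ => j) = (S j).1 := by
    intro j
    -- For `k = 0` this supremum is `0`, not `j`, so the two stages are compared through their
    -- degrees, which agree as functions on `Fin k`.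
    have hle : (Finset.univ.sup fun _ : Fin k => j) ≤ j := Finset.sup_le fun _ _ => le_rfl
    have e : (fun _ : Fin k => Finset.univ.sup fun _ : Fin k => j) = fun _ => j :=
      funext fun i => le_antisymm hle (Finset.le_sup (f := fun _ : Fin k => j) (Finset.mem_univ i))
    have h := hx fun _ => j
    rw [e] at h
    rw [h]
    exact Λ.eq_of_isPrefix (hmono _ _ hle) (.refl _) (by rw [hdeg, hdeg, e])
  refine ⟨x, ?_, fun j => by rw [hx1]; exact (S j).2⟩
  have := hx1 0
  rw [← x.range_apply fun _ => 0]
  exact congrArg KPath.range this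

theorem exists_rng_eq [Λ.NoSources] (v : C) : ∃ x : Λ.IPath, x.rng = v := by
  obtain ⟨x, hx, -⟩ := exists_forall_source (Λ := Λ) (P := fun _ => True)
    (fun v _ => (NoSources.exists_path (Λ := Λ) v 1).imp fun _ h => ⟨h.1, h.2, trivial⟩)
    (v := v) trivial
  exact ⟨x, hx⟩

/-- The initial segments of an infinite path given as a functor. -/
def ofInfinitePath (x : Λ.InfinitePath) : Λ.IPath where
  toFun n := ⟨x.toFunctor.map (X := ⟨n⟩) (Y := ⟨0⟩) ⟨zero_le⟩⟩
  deg_toFun n := (x.degree_map _).trans (tsub_zero n)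
  isPrefix {m n} h := ⟨⟨x.toFunctor.map (X := ⟨n⟩) (Y := ⟨m⟩) ⟨h⟩⟩, rfl, by
    rw [cat_mk, ← x.toFunctor.map_comp]; rfl⟩

theorem exists_hom (x : Λ.IPath) {m n : Fin k → ℕ} (h : m ≤ n) :
    ∃ f : (x n).source ⟶ (x m).source, Λ.degree f = n - m ∧ cat (x m) ⟨f⟩ = x n := by
  obtain ⟨⟨f⟩, hf, he⟩ := x.isPrefix h
  rename_i a b
  dsimp only at hf
  subst hf
  have ha : (x n).source = a := by rw [← he, cat_source rfl]
  subst ha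
  refine ⟨f, ?_, he⟩
  have := x.deg_toFun n
  rw [← he, Λ.deg_cat rfl, x.deg_toFun] at this
  exact eq_tsub_of_add_eq ((add_comm _ _).trans this)

/-- Left cancellation makes the connecting morphisms chosen in `toInfinitePath` compatible with
identities and composition. -/
theorem hom_unique (x : Λ.IPath) {m n : Fin k → ℕ} {f g : (x n).source ⟶ (x m).source}
    (h : cat (x m) ⟨f⟩ = cat (x m) ⟨g⟩) : f = g := by
  have := (Λ.cat_inj (g := ⟨f⟩) (g' := ⟨g⟩) rfl rfl rfl h).2
  cases this
  rfl

/-- The functor given by an infinite path. -/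
noncomputable def toInfinitePath (x : Λ.IPath) : Λ.InfinitePath where
  toFunctor :=
    { obj := fun n => (x n.pt).source
      map := fun f => (x.exists_hom f.down).choose
      map_id := fun n => x.hom_unique <| by
        rw [(x.exists_hom le_rfl).choose_spec.2, cat_id]
      map_comp := fun {a b c} f g => x.hom_unique <| by
        rw [(x.exists_hom (f ≫ g).down).choose_spec.2, ← cat_mk,
          ← cat_assoc rfl rfl, (x.exists_hom g.down).choose_spec.2,
          (x.exists_hom f.down).choose_spec.2] }
  degree_map f := (x.exists_hom f.down).choose_spec.1

/-- `x.Act l y` means that `x = l y`. -/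
def Act (l : KPath C) (y x : Λ.IPath) : Prop :=
  l.source = y.rng ∧ ∀ n, x (Λ.deg l + n) = cat l (y n)

end IPath

/-- A set with an action of the paths of `Λ` by partial injections (`Act l y x` says `x = l y`) such
that each point has a unique factorization `l y` for each degree of `l`. -/
structure BranchingSystem (X : Type*) where
  rng : X → C
  Act : KPath C → X → X → Prop
  source_eq : ∀ {l y x}, Act l y x → l.source = rng y
  range_eq : ∀ {l y x}, Act l y x → l.range = rng x
  exists_act : ∀ {l y}, l.source = rng y → ∃ x, Act l y x
  act_unique : ∀ {l y x x'}, Act l y x → Act l y x' → x = x'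
  exists_factor : ∀ x n, ∃ l y, Λ.deg l = n ∧ Act l y x
  factor_unique : ∀ {l y l' y' x}, Λ.deg l = Λ.deg l' → Act l y x → Act l' y' x → l = l' ∧ y = y'
  act_cat : ∀ {f g x y z}, Act g z y → Act f y x → Act (cat f g) z x
  act_id : ∀ x, Act ⟨𝟙 (rng x)⟩ x x

/-- The branching system of infinite paths. -/
def IPath.system : Λ.BranchingSystem Λ.IPath where
  rng := rng
  Act := Act
  source_eq h := h.1
  range_eq {l y x} h := by rw [← x.range_apply, h.2 0, cat_range]
  exists_act {l y} h := by
    have h' : ∀ n, (y n).range = l.source := fun n => (y.range_apply n).trans h.symm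
    obtain ⟨x, hx⟩ := exists_of_monotone (Λ := Λ) (fun n => cat l (y n))
      (fun n => by rw [Λ.deg_cat (h' n), y.deg_toFun]; exact le_add_self)
      (fun m n hmn => (y.isPrefix hmn).cat_left (h' m))
    refine ⟨x, h, fun n => ?_⟩
    rw [← hx, Λ.deg_cat (h' n), y.deg_toFun]
  act_unique h h' := ext_of_frequently fun n => ⟨_, le_add_self, (h.2 n).trans (h'.2 n).symm⟩
  exists_factor x n := by
    -- The tail of `x` after `x n`: its segment of degree `m` is what remains of `x (n + m)` once `x
    -- n` is removed.
    choose g hg he using fun m => x.isPrefix (le_self_add : n ≤ n + m)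
    refine ⟨x n, ⟨g, fun m => ?_, fun {m m'} h => ?_⟩, x.deg_toFun n, ?_, fun m => ?_⟩
    · have := congrArg Λ.deg (he m)
      rw [Λ.deg_cat (hg m), x.deg_toFun, x.deg_toFun] at this
      exact add_left_cancel this
    · refine Λ.isPrefix_of_cat (hg m) (hg m') ?_
      rw [he, he]
      exact x.isPrefix (add_le_add_right h n)
    · exact (hg 0).symm
    · exact (congrArg (fun d => x (d + m)) (x.deg_toFun n)).trans (he m).symm
  factor_unique {l y l' y' x} hd h h' := by
    have H : ∀ n, l = l' ∧ y n = y' n := fun n =>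
      Λ.cat_inj ((y.range_apply n).trans h.1.symm) ((y'.range_apply n).trans h'.1.symm) hd
        (by rw [← h.2, ← h'.2, hd])
    exact ⟨(H 0).1, ext_of_frequently fun n => ⟨n, le_rfl, (H n).2⟩⟩
  act_cat {f g x y z} h h' := by
    have hr : g.range = f.source := by rw [h'.1, ← y.range_apply, h.2 0, cat_range]
    refine ⟨by rw [cat_source hr, h.1], fun n => ?_⟩
    rw [Λ.deg_cat hr, add_assoc, h'.2, h.2, cat_assoc hr ((z.range_apply n).trans h.1.symm)]
  act_id x := by
    refine ⟨rfl, fun n => ?_⟩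
    rw [show Λ.deg ⟨𝟙 x.rng⟩ = 0 from Λ.degree_id _, zero_add, ← x.range_apply n, id_cat]

namespace BranchingSystem

variable {Λ} {X : Type*} (B : Λ.BranchingSystem X)

/-- The restriction of a branching system to an invariant subset. -/
def restrict (P : X → Prop) (hP : ∀ {l y x}, B.Act l y x → (P y ↔ P x)) :
    Λ.BranchingSystem {x // P x} where
  rng x := B.rng x
  Act l y x := B.Act l y x
  source_eq h := B.source_eq h
  range_eq h := B.range_eq h
  exists_act {_ y} h := by
    obtain ⟨x, hx⟩ := B.exists_act h
    exact ⟨⟨x, (hP hx).1 y.2⟩, hx⟩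
  act_unique h h' := Subtype.ext (B.act_unique h h')
  exists_factor x n := by
    obtain ⟨l, y, hl, h⟩ := B.exists_factor x n
    exact ⟨l, ⟨y, (hP h).2 x.2⟩, hl, h⟩
  factor_unique hd h h' := (B.factor_unique hd h h').imp_right Subtype.ext
  act_cat h h' := B.act_cat h h'
  act_id x := B.act_id x

/-- The product of a branching system with `ℤ ^ k`, on which paths act by translation by their
degree. -/
def skew : Λ.BranchingSystem (X × (Fin k → ℤ)) where
  rng x := B.rng x.1
  Act l y x := B.Act l y.1 x.1 ∧ x.2 = y.2 + fun i => (Λ.deg l i : ℤ)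
  source_eq h := B.source_eq h.1
  range_eq h := B.range_eq h.1
  exists_act {_ y} h := by
    obtain ⟨x, hx⟩ := B.exists_act h
    exact ⟨⟨x, _⟩, hx, rfl⟩
  act_unique h h' := Prod.ext (B.act_unique h.1 h'.1) (h.2.trans h'.2.symm)
  exists_factor x n := by
    obtain ⟨l, y, hl, h⟩ := B.exists_factor x.1 n
    exact ⟨l, ⟨y, x.2 - fun i => (Λ.deg l i : ℤ)⟩, hl, h, (sub_add_cancel _ _).symm⟩
  factor_unique hd h h' := by
    obtain ⟨rfl, h1⟩ := B.factor_unique hd h.1 h'.1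
    exact ⟨rfl, Prod.ext h1 (add_right_cancel (h.2.symm.trans h'.2))⟩
  act_cat {f g _ _ _} h h' := by
    refine ⟨B.act_cat h.1 h'.1, ?_⟩
    rw [h'.2, h.2, Λ.deg_cat ((B.range_eq h.1).trans (B.source_eq h'.1).symm)]
    funext i
    simp only [Pi.add_apply, Nat.cast_add]
    ring
  act_id x := by
    refine ⟨B.act_id _, ?_⟩
    rw [show Λ.deg ⟨𝟙 (B.rng x.1)⟩ = 0 from Λ.degree_id _]
    funext i
    simp

end BranchingSystem

end KGraph

/-! ### Substitution operators along partial maps -/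

/-- The linear operator on functions which substitutes along a functional relation, and is zero
outside its domain. -/
noncomputable def LinearMap.pullRel {X : Type*} (R A : Type*) [CommRing R] [AddCommGroup A]
    [Module R A] (ρ : X → X → Prop) : Module.End R (X → A) :=
  open Classical in
  { toFun := fun f x => if h : ∃ y, ρ x y then f h.choose else 0
    map_add' := fun f g => by
      funext x
      by_cases h : ∃ y, ρ x y <;> simp [h]
    map_smul' := fun r f => by
      funext x
      by_cases h : ∃ y, ρ x y <;> simp [h] }

namespace LinearMap

variable {X R A : Type*} [CommRing R] [AddCommGroup A] [Module R A] {ρ τ : X → X → Prop}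

theorem pullRel_apply (hρ : Relator.RightUnique ρ) (f : X → A) {x y : X} (h : ρ x y) :
    pullRel R A ρ f x = f y := by
  have h' : ∃ y, ρ x y := ⟨y, h⟩
  simp only [pullRel, coe_mk, AddHom.coe_mk, dif_pos h']
  rw [hρ h'.choose_spec h]

theorem pullRel_apply_of_not (f : X → A) {x : X} (h : ∀ y, ¬ ρ x y) :
    pullRel R A ρ f x = 0 := by
  simp [pullRel, h]

theorem pullRel_eq_zero (h : ∀ x y, ¬ ρ x y) : pullRel R A ρ = 0 := by
  ext1 f
  funext x
  exact pullRel_apply_of_not f (h x)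

theorem pullRel_mul (hρ : Relator.RightUnique ρ) (hτ : Relator.RightUnique τ) :
    pullRel R A ρ * pullRel R A τ = pullRel R A (Relation.Comp ρ τ) := by
  ext1 f
  funext x
  have hc : Relator.RightUnique (Relation.Comp ρ τ) := by
    rintro a b c ⟨d, h1, h2⟩ ⟨d', h1', h2'⟩
    obtain rfl := hρ h1 h1'
    exact hτ h2 h2'
  rw [Module.End.mul_apply]
  by_cases h : ∃ y, ρ x y
  · obtain ⟨y, hy⟩ := h
    rw [pullRel_apply hρ _ hy]
    by_cases h' : ∃ z, τ y z
    · obtain ⟨z, hz⟩ := h'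
      rw [pullRel_apply hτ _ hz, pullRel_apply hc _ ⟨y, hy, hz⟩]
    · push Not at h'
      rw [pullRel_apply_of_not _ h', pullRel_apply_of_not]
      rintro z ⟨y', h1, h2⟩
      obtain rfl := hρ hy h1
      exact h' z h2
  · push Not at h
    rw [pullRel_apply_of_not _ h, pullRel_apply_of_not]
    rintro z ⟨y, h1, -⟩
    exact h y h1

end LinearMap

/-! ### The representation of the Kumjian–Pask algebra on a branching system -/

namespace KGraph

open KPath LinearMap

variable {k : ℕ} {C : Type u} [Category.{v} C] {Λ : KGraph k C}

namespace BranchingSystem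

variable {X : Type*} (B : Λ.BranchingSystem X)

/-- This makes the convention that degree-zero paths stand for vertices consistent with the
operators in `genOp`, so that `freeRep_freeS` and `freeRep_freeT` need no case distinction. -/
theorem act_of_deg_eq_zero {l : KPath C} (hl : Λ.deg l = 0) {x y : X} :
    B.Act l y x ↔ x = y ∧ B.rng x = l.range := by
  constructor
  · intro h
    have hd : Λ.deg l = Λ.deg ⟨𝟙 (B.rng x)⟩ := hl.trans (Λ.degree_id _).symm
    obtain ⟨-, rfl⟩ := B.factor_unique hd h (B.act_id x)
    exact ⟨rfl, (B.range_eq h).symm⟩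
  · rintro ⟨rfl, h⟩
    rw [Λ.eq_id_of_deg_eq_zero hl, ← h]
    exact B.act_id x

theorem act_comp {f g : KPath C} (h : g.range = f.source) {x z : X} :
    B.Act (cat f g) z x ↔ ∃ y, B.Act f y x ∧ B.Act g z y := by
  constructor
  · intro hx
    obtain ⟨y, hy⟩ := B.exists_act ((cat_source h).symm.trans (B.source_eq hx))
    obtain ⟨x', hx'⟩ := B.exists_act (h.symm.trans (B.range_eq hy))
    obtain rfl := B.act_unique (B.act_cat hy hx') hx
    exact ⟨y, hx', hy⟩
  · rintro ⟨y, h1, h2⟩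
    exact B.act_cat h2 h1

theorem rightUnique_act (l : KPath C) : Relator.RightUnique fun x y => B.Act l x y :=
  fun _ _ _ h h' => B.act_unique h h'

theorem rightUnique_act_symm (l : KPath C) : Relator.RightUnique fun x y => B.Act l y x :=
  fun _ _ _ h h' => (B.factor_unique rfl h h').2

theorem rightUnique_vertex (v : C) : Relator.RightUnique fun x y => x = y ∧ B.rng x = v :=
  fun _ _ _ h h' => h.1.symm.trans h'.1

variable (R A : Type*) [CommRing R] [AddCommGroup A] [Module R A]

/-- The operators of the generators on the functions on a branching system. -/
noncomputable def genOp : Λ.Gen → Module.End R (X → A)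
  | .vertex v => pullRel R A fun x y => x = y ∧ B.rng x = v
  | .path l _ => pullRel R A fun x y => B.Act l y x
  | .ghost l _ => pullRel R A fun x y => B.Act l x y

/-- The representation of the free algebra on the functions on a branching system. -/
noncomputable def freeRep : Λ.FreeAlg R →ₙₐ[R] Module.End R (X → A) :=
  MonoidAlgebra.liftMagma R (FreeSemigroup.lift (B.genOp R A))

theorem freeRep_gen (x : Λ.Gen) : B.freeRep R A (Λ.gen R x) = B.genOp R A x := by
  simp [freeRep, gen, MonoidAlgebra.liftMagma]

theorem freeRep_freeP (v : C) :
    B.freeRep R A (Λ.freeP R v) = pullRel R A fun x y => x = y ∧ B.rng x = v :=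
  B.freeRep_gen R A _

theorem freeRep_freeS (l : KPath C) :
    B.freeRep R A (Λ.freeS R l) = pullRel R A fun x y => B.Act l y x := by
  by_cases h : Λ.deg l = 0
  · simp only [freeS, dif_pos h, freeRep_freeP, B.act_of_deg_eq_zero h]
  · rw [freeS, dif_neg h, freeRep_gen]; rfl

theorem freeRep_freeT (l : KPath C) :
    B.freeRep R A (Λ.freeT R l) = pullRel R A fun x y => B.Act l x y := by
  by_cases h : Λ.deg l = 0
  · simp only [freeT, dif_pos h, freeRep_freeP, B.act_of_deg_eq_zero h]
    congr 1
    funext x y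
    exact propext ⟨fun h => ⟨h.1.symm, h.1 ▸ h.2⟩, fun h => ⟨h.1.symm, h.1 ▸ h.2⟩⟩
  · rw [freeT, dif_neg h, freeRep_gen]; rfl

theorem pullRel_mul_eq {ρ τ σ : X → X → Prop} (hρ : Relator.RightUnique ρ)
    (hτ : Relator.RightUnique τ) (h : ∀ x y, Relation.Comp ρ τ x y ↔ σ x y) :
    pullRel R A ρ * pullRel R A τ = pullRel R A σ := by
  rw [pullRel_mul hρ hτ]
  congr 1
  funext x y
  exact propext (h x y)

theorem pullRel_mul_eq_zero {ρ τ : X → X → Prop} (hρ : Relator.RightUnique ρ)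
    (hτ : Relator.RightUnique τ) (h : ∀ x y z, ρ x y → ¬ τ y z) :
    pullRel R A ρ * pullRel R A τ = 0 := by
  rw [pullRel_mul hρ hτ]
  exact pullRel_eq_zero fun x z ⟨y, h1, h2⟩ => h x y z h1 h2

/-- Each product of two generators becomes a composition of partial injections. The last two
families of relations hold because the images of the paths of a fixed degree are pairwise disjoint
and cover the system. -/
theorem freeRep_eq_of_rel [Λ.RowFinite] {a b : Λ.FreeAlg R} (h : Λ.Rel R a b) :
    B.freeRep R A a = B.freeRep R A b := by
  have hs := B.rightUnique_act_symm
  have ht := B.rightUnique_act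
  have hp := B.rightUnique_vertex
  cases h with
  | kp1_self v =>
    simp only [map_mul, freeRep_freeP]
    refine pullRel_mul_eq R A (hp v) (hp v) fun x y => ⟨?_, fun h => ⟨x, ⟨rfl, h.2⟩, h⟩⟩
    rintro ⟨z, ⟨rfl, h⟩, h'⟩
    exact h'
  | kp1_ne v w h =>
    simp only [map_mul, map_zero, freeRep_freeP]
    refine pullRel_mul_eq_zero R A (hp v) (hp w) ?_
    rintro x y z ⟨rfl, h1⟩ ⟨-, h2⟩
    exact h (h1.symm.trans h2)
  | kp2_path l m hl hm =>
    simp only [map_mul, freeRep_freeS]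
    refine pullRel_mul_eq R A (hs _) (hs _) fun x y => ?_
    rw [← cat_mk, B.act_comp rfl]
    rfl
  | kp2_ghost l m hl hm =>
    simp only [map_mul, freeRep_freeT]
    refine pullRel_mul_eq R A (ht _) (ht _) fun x y => ?_
    rw [← cat_mk, B.act_comp rfl]
    exact exists_congr fun _ => and_comm
  | kp2_range_path l hl =>
    simp only [map_mul, freeRep_freeP, freeRep_freeS]
    refine pullRel_mul_eq R A (hp _) (hs _) fun x y => ⟨?_, fun h => ⟨x, ⟨rfl, ?_⟩, h⟩⟩
    · rintro ⟨z, ⟨rfl, -⟩, h⟩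
      exact h
    · exact (B.range_eq h).symm
  | kp2_path_source l hl =>
    simp only [map_mul, freeRep_freeP, freeRep_freeS]
    refine pullRel_mul_eq R A (hs _) (hp _) fun x y => ⟨?_, fun h => ⟨y, h, rfl, ?_⟩⟩
    · rintro ⟨z, h, rfl, -⟩
      exact h
    · exact (B.source_eq h).symm
  | kp2_source_ghost l hl =>
    simp only [map_mul, freeRep_freeP, freeRep_freeT]
    refine pullRel_mul_eq R A (hp _) (ht _) fun x y => ⟨?_, fun h => ⟨x, ⟨rfl, ?_⟩, h⟩⟩
    · rintro ⟨z, ⟨rfl, -⟩, h⟩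
      exact h
    · exact (B.source_eq h).symm
  | kp2_ghost_range l hl =>
    simp only [map_mul, freeRep_freeP, freeRep_freeT]
    refine pullRel_mul_eq R A (ht _) (hp _) fun x y => ⟨?_, fun h => ⟨y, h, rfl, ?_⟩⟩
    · rintro ⟨z, h, rfl, -⟩
      exact h
    · exact (B.range_eq h).symm
  | kp3_self l hl =>
    simp only [map_mul, freeRep_freeP, freeRep_freeS, freeRep_freeT]
    refine pullRel_mul_eq R A (ht _) (hs _) fun x y => ⟨?_, ?_⟩
    · rintro ⟨z, h1, h2⟩
      exact ⟨hs l h1 h2, (B.source_eq h1).symm⟩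
    · rintro ⟨rfl, h⟩
      obtain ⟨z, hz⟩ := B.exists_act h.symm
      exact ⟨z, hz, hz⟩
  | kp3_ne l m hl h hne =>
    simp only [map_mul, map_zero, freeRep_freeS, freeRep_freeT]
    exact pullRel_mul_eq_zero R A (ht _) (hs _) fun x y z h1 h2 => hne (B.factor_unique h h1 h2).1
  | kp4 v n hn =>
    simp only [map_mul, map_sum, freeRep_freeP, freeRep_freeS, freeRep_freeT]
    ext1 f
    funext x
    have hmul : ∀ l : KPath C, (pullRel R A fun x y => B.Act l y x) *
        (pullRel R A fun x y => B.Act l x y) = pullRel R A fun x y => x = y ∧ ∃ z, B.Act l z x := by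
      intro l
      refine pullRel_mul_eq R A (hs _) (ht _) fun x y => ⟨?_, ?_⟩
      · rintro ⟨z, h1, h2⟩
        exact ⟨ht l h1 h2, z, h1⟩
      · rintro ⟨rfl, z, h⟩
        exact ⟨z, h, h⟩
    have hu : ∀ l : KPath C, Relator.RightUnique fun x y : X => x = y ∧ ∃ z, B.Act l z x :=
      fun l _ _ _ h h' => h.1.symm.trans h'.1
    simp only [hmul, LinearMap.sum_apply, Finset.sum_apply]
    -- Only the path `l` of degree `n` through which `x` factors can contribute at `x`, and it
    -- occurs in the sum exactly when `x` has range `v`.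
    obtain ⟨l, y, hl, hy⟩ := B.exists_factor x n
    have hne : ∀ l' ∈ Λ.pathsInto v n, l' ≠ l →
        pullRel R A (fun x y => x = y ∧ ∃ z, B.Act l' z x) f x = 0 := by
      intro l' hl' hll
      refine pullRel_apply_of_not _ ?_
      rintro _ ⟨rfl, z, hz⟩
      simp only [pathsInto, Set.Finite.mem_toFinset, Set.mem_ofPred_eq] at hl'
      exact hll (B.factor_unique (hl'.2.trans hl.symm) hz hy).1
    by_cases hv : B.rng x = v
    · rw [pullRel_apply (hp v) f ⟨rfl, hv⟩, Finset.sum_eq_single l hne]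
      · rw [pullRel_apply (hu l) f ⟨rfl, y, hy⟩]
      · intro h
        simp only [pathsInto, Set.Finite.mem_toFinset, Set.mem_ofPred_eq] at h
        exact absurd ⟨(B.range_eq hy).trans hv, hl⟩ h
    · rw [pullRel_apply_of_not f fun z hz => hv hz.2, Finset.sum_eq_zero]
      intro l' hl'
      refine hne l' hl' ?_
      rintro rfl
      simp only [pathsInto, Set.Finite.mem_toFinset, Set.mem_ofPred_eq] at hl'
      exact hv ((B.range_eq hy).symm.trans hl'.1)

theorem freeRep_eq_zero [Λ.RowFinite] {a : Λ.FreeAlg R} (h : a ∈ Λ.kpIdeal R) :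
    B.freeRep R A a = 0 := by
  unfold kpIdeal at h
  induction h using TwoSidedIdeal.span_induction with
  | mem x h =>
    obtain ⟨r, a, b, h, rfl⟩ := h
    rw [map_smul, map_sub, B.freeRep_eq_of_rel R A h, sub_self, smul_zero]
  | zero => exact map_zero _
  | add x y _ _ hx hy => rw [map_add, hx, hy, add_zero]
  | neg x _ hx => rw [map_neg, hx, neg_zero]
  | left_absorb a x _ hx => rw [map_mul, hx, mul_zero]
  | right_absorb b x _ hx => rw [map_mul, hx, zero_mul]

variable [Λ.RowFinite]

theorem freeRep_eq_of_toKP_eq {a b : Λ.FreeAlg R} (h : Λ.toKP R a = Λ.toKP R b) :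
    B.freeRep R A a = B.freeRep R A b := by
  rw [← sub_eq_zero, ← map_sub]
  exact B.freeRep_eq_zero R A ((Λ.toKP_eq_iff R a b).1 h)

/-- The representation of the Kumjian-Pask algebra on the functions on a branching system. -/
noncomputable def rep : Λ.KP R →ₙ+* Module.End R (X → A) where
  toFun x := B.freeRep R A (Λ.toKP_surjective R x).choose
  map_zero' := by
    rw [B.freeRep_eq_of_toKP_eq R A (b := 0), map_zero]
    rw [(Λ.toKP_surjective R 0).choose_spec, map_zero]
  map_add' x y := by
    rw [← map_add]
    apply B.freeRep_eq_of_toKP_eq R A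
    simp only [map_add, (Λ.toKP_surjective R _).choose_spec]
  map_mul' x y := by
    rw [← map_mul]
    apply B.freeRep_eq_of_toKP_eq R A
    simp only [map_mul, (Λ.toKP_surjective R _).choose_spec]

theorem rep_toKP (a : Λ.FreeAlg R) : B.rep R A (Λ.toKP R a) = B.freeRep R A a :=
  B.freeRep_eq_of_toKP_eq R A (Λ.toKP_surjective R _).choose_spec

theorem rep_smul (r : R) (x : Λ.KP R) : B.rep R A (r • x) = r • B.rep R A x := by
  obtain ⟨x, rfl⟩ := Λ.toKP_surjective R x
  rw [← toKP_smul, rep_toKP, rep_toKP, map_smul]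

theorem rep_p (v : C) : B.rep R A (Λ.p R v) = pullRel R A fun x y => x = y ∧ B.rng x = v :=
  (B.rep_toKP R A _).trans (B.freeRep_freeP R A v)

theorem rep_s (l : KPath C) : B.rep R A (Λ.s R l) = pullRel R A fun x y => B.Act l y x :=
  (B.rep_toKP R A _).trans (B.freeRep_freeS R A l)

variable {R A}

theorem rep_p_apply {v : C} {x : X} (h : B.rng x = v) (f : X → A) :
    B.rep R A (Λ.p R v) f x = f x := by
  rw [rep_p, pullRel_apply (B.rightUnique_vertex v) f ⟨rfl, h⟩]

end BranchingSystem

end KGraph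

/-! ### Orthogonality from aperiodicity, and a normal form for elements -/

namespace KGraph

open KPath

variable {k : ℕ} {C : Type u} [Category.{v} C] (Λ : KGraph k C) [Λ.RowFinite]
variable (R : Type w) [CommRing R]

theorem mem_pathsInto {v : C} {n : Fin k → ℕ} {l : KPath C} :
    l ∈ Λ.pathsInto v n ↔ l.range = v ∧ Λ.deg l = n := by
  simp [pathsInto]

theorem s_cat {f g : KPath C} (h : g.range = f.source) :
    Λ.s R (cat f g) = Λ.s R f * Λ.s R g := by
  obtain ⟨f⟩ := f; obtain ⟨g⟩ := g
  dsimp only at h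
  subst h
  rw [cat_mk, s_mul_s]

theorem sStar_cat {f g : KPath C} (h : g.range = f.source) :
    Λ.sStar R (cat f g) = Λ.sStar R g * Λ.sStar R f := by
  obtain ⟨f⟩ := f; obtain ⟨g⟩ := g
  dsimp only at h
  subst h
  rw [cat_mk, sStar_mul_sStar]

theorem s_mul_sStar_of_source_ne {l m : KPath C} (h : l.source ≠ m.source) :
    Λ.s R l * Λ.sStar R m = 0 := by
  rw [← Λ.s_mul_p R l, ← Λ.p_mul_sStar R m, mul_assoc, ← mul_assoc (Λ.p R _),
    Λ.p_mul_of_ne R h, zero_mul, mul_zero]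

/-- Paths without a common extension are orthogonal. -/
theorem sStar_mul_s_eq_zero {l m : KPath C} (h : ∀ c, IsPrefix l c → ¬ IsPrefix m c) :
    Λ.sStar R l * Λ.s R m = 0 := by
  -- Extending `l` by all `g` of degree `d(m)` makes `lg` long enough to have a prefix of degree
  -- `d(m)`; this prefix is not `m`, since otherwise `lg` would be a common extension.
  rw [← Λ.p_mul_sStar R l, Λ.p_eq_sum R _ (Λ.deg m), Finset.sum_mul, Finset.sum_mul]
  refine Finset.sum_eq_zero fun g hg => ?_
  rw [mem_pathsInto] at hg
  obtain ⟨hg, hd⟩ := hg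
  rw [mul_assoc (Λ.s R g), ← Λ.sStar_cat R hg]
  obtain ⟨a, b, hab, ha, he⟩ := Λ.exists_cat (cat l g) (n := Λ.deg m)
    (by rw [Λ.deg_cat hg, hd]; exact le_add_self)
  have hne : a ≠ m := by
    intro ham
    exact h _ (isPrefix_cat hg) ⟨b, ham ▸ hab, ham ▸ he⟩
  rw [← he, Λ.sStar_cat R hab, mul_assoc, mul_assoc, Λ.sStar_mul_s_of_ne R ha hne, mul_zero,
    mul_zero]

variable {Λ}

/-- In an aperiodic graph, two different paths with the same source can be made orthogonal by
extending both by the same path. -/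
theorem Aperiodic.exists_orthogonal (hΛ : Λ.Aperiodic) {γ α : KPath C} (hs : γ.source = α.source)
    (hne : γ ≠ α) : ∃ l : KPath C, l.range = γ.source ∧
      Λ.sStar R (cat γ l) * Λ.s R (cat α l) = 0 := by
  by_cases hd : Λ.deg γ = Λ.deg α
  · refine ⟨⟨𝟙 γ.source⟩, rfl, ?_⟩
    rw [cat_id, hs, cat_id, Λ.sStar_mul_s_of_ne R hd hne]
  -- The degrees are crossed: the segment of `l` at `d(α)` inside `γl` and the segment of `l` at
  -- `d(γ)` inside `αl` both start at `d(γ) + d(α)`. A common extension of `γl` and `αl` would make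
  -- these segments equal.
  obtain ⟨l, hl, hle, x, y, hx, hy, hxy⟩ := hΛ γ.source (Λ.deg α) (Λ.deg γ) (Ne.symm hd)
  refine ⟨l, hl, Λ.sStar_mul_s_eq_zero R fun c h₁ h₂ => hxy ?_⟩
  obtain ⟨hdx, f, hf, hfd, hfx⟩ := Λ.isSegment_iff.1 hx
  obtain ⟨hdy, g, hg, hgd, hgy⟩ := Λ.isSegment_iff.1 hy
  have hf' : f.range = γ.source := by rw [← hl, ← hfx.range_eq, cat_range]
  have hg' : g.range = α.source := by rw [← hs, ← hl, ← hgy.range_eq, cat_range]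
  have h1 : IsPrefix (cat (cat γ f) x) c := by
    rw [cat_assoc hf' hf]
    exact (hfx.cat_left (by rw [cat_range, hf'])).trans h₁
  have h2 : IsPrefix (cat (cat α g) y) c := by
    rw [cat_assoc hg' hg]
    exact (hgy.cat_left (by rw [cat_range, hg'])).trans h₂
  have hfx' : x.range = (cat γ f).source := by rw [cat_source hf', hf]
  have hgy' : y.range = (cat α g).source := by rw [cat_source hg', hg]
  have hde : Λ.deg (cat γ f) = Λ.deg (cat α g) := by
    rw [Λ.deg_cat hf', Λ.deg_cat hg', hfd, hgd, add_comm]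
  refine (Λ.cat_inj hfx' hgy' hde (Λ.eq_of_isPrefix h1 h2 ?_)).2
  rw [Λ.deg_cat hfx', Λ.deg_cat hgy', hde, add_left_cancel hdx, add_left_cancel hdy]

/-- The paths of `A` can be treated one after another, because orthogonality survives further
extension: `s_{(γll')^*} s_{αll'} = s_{l'^*} (s_{(γl)^*} s_{αl}) s_{l'}`. -/
theorem Aperiodic.exists_orthogonal_finset (hΛ : Λ.Aperiodic) (γ : KPath C)
    (A : Finset (KPath C)) : ∃ l : KPath C, l.range = γ.source ∧
      ∀ α ∈ A, γ.source = α.source → γ ≠ α → Λ.sStar R (cat γ l) * Λ.s R (cat α l) = 0 := by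
  classical
  induction A using Finset.induction_on with
  | empty => exact ⟨⟨𝟙 γ.source⟩, rfl, by simp⟩
  | insert β A _ ih =>
    obtain ⟨l, hl, h⟩ := ih
    have hext : ∀ l' : KPath C, l'.range = l.source → ∀ α : KPath C, γ.source = α.source →
        Λ.sStar R (cat γ l) * Λ.s R (cat α l) = 0 →
        Λ.sStar R (cat γ (cat l l')) * Λ.s R (cat α (cat l l')) = 0 := by
      intro l' hl' α hs h0
      rw [← cat_assoc hl hl', ← cat_assoc (hl.trans hs) hl',
        Λ.sStar_cat R (hl'.trans (cat_source hl).symm),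
        Λ.s_cat R (hl'.trans (cat_source (hl.trans hs)).symm), mul_assoc,
        ← mul_assoc (Λ.sStar R (cat γ l)), h0, zero_mul, mul_zero]
    by_cases hβ : γ.source = β.source ∧ γ ≠ β
    · obtain ⟨l', hl', h'⟩ := hΛ.exists_orthogonal R (γ := cat γ l) (α := cat β l)
        (by rw [cat_source hl, cat_source (hl.trans hβ.1)])
        (fun he => by
          have hd := congrArg Λ.deg he
          rw [Λ.deg_cat hl, Λ.deg_cat (hl.trans hβ.1)] at hd
          exact hβ.2 (Λ.cat_inj hl (hl.trans hβ.1) (add_right_cancel hd) he).1)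
      rw [cat_source hl] at hl'
      refine ⟨cat l l', by rw [cat_range, hl], fun α hα hs hne => ?_⟩
      rcases Finset.mem_insert.1 hα with rfl | hα
      · rwa [cat_assoc hl hl', cat_assoc (hl.trans hs) hl'] at h'
      · exact hext l' hl' α hs (h α hα hs hne)
    · refine ⟨l, hl, fun α hα hs hne => ?_⟩
      rcases Finset.mem_insert.1 hα with rfl | hα
      · exact absurd ⟨hs, hne⟩ hβ
      · exact h α hα hs hne

variable (Λ)

/-- The set of pairs `(l, m)` of paths with the same source and `d(m) = n`. -/
def pairsOfDegree (n : Fin k → ℕ) : Set (KPath C × KPath C) :=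
  {q | q.1.source = q.2.source ∧ Λ.deg q.2 = n}

/-- Expanding the idempotent at the common source over paths of degree `n - d(m)` lengthens every
ghost to degree exactly `n`. -/
theorem s_mul_sStar_mem_span_pairs {l m : KPath C} {n : Fin k → ℕ} (h : Λ.deg m ≤ n) :
    Λ.s R l * Λ.sStar R m ∈ Submodule.span R
      ((fun q : KPath C × KPath C => Λ.s R q.1 * Λ.sStar R q.2) '' Λ.pairsOfDegree n) := by
  by_cases hs : l.source = m.source
  · rw [← Λ.s_mul_p R l, Λ.p_eq_sum R _ (n - Λ.deg m), Finset.mul_sum, Finset.sum_mul]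
    refine Submodule.sum_mem _ fun g hg => ?_
    obtain ⟨hg, hd⟩ := Λ.mem_pathsInto.1 hg
    rw [← mul_assoc, mul_assoc, ← Λ.s_cat R hg, ← Λ.sStar_cat R (hg.trans hs)]
    refine Submodule.subset_span ⟨(cat l g, cat m g), ⟨?_, ?_⟩, rfl⟩
    · rw [cat_source hg, cat_source (hg.trans hs)]
    · rw [Λ.deg_cat (hg.trans hs), hd, add_tsub_cancel_of_le h]
  · rw [Λ.s_mul_sStar_of_source_ne R hs]
    exact Submodule.zero_mem _

theorem mem_indSpan_top (x : Λ.KP R) : x ∈ Λ.indSpan R ⊤ := by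
  induction x using Λ.kp_induction R with
  | hs l =>
    rw [← Λ.s_mul_p R l, ← Λ.sStar_id, ← one_smul R (_ * _)]
    exact Λ.mem_indSpan Submodule.mem_top _ _
  | ht l =>
    rw [← Λ.p_mul_sStar R l, ← Λ.s_id, ← one_smul R (_ * _)]
    exact Λ.mem_indSpan Submodule.mem_top _ _
  | zero => exact Submodule.zero_mem _
  | add x y hx hy => exact Submodule.add_mem _ hx hy
  | mul x y _ hy => exact Λ.mul_mem_indSpan_left _ hy
  | smul r x hx => exact Submodule.smul_mem _ _ hx

/-- With all ghosts of one degree, right multiplication by `s_δ` annihilates every term whose ghost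
is not that of `δ`. -/
theorem exists_mem_span_pairs (x : Λ.KP R) : ∃ n : Fin k → ℕ, x ∈ Submodule.span R
    ((fun q : KPath C × KPath C => Λ.s R q.1 * Λ.sStar R q.2) '' Λ.pairsOfDegree n) := by
  have hx := Λ.mem_indSpan_top R x
  unfold indSpan at hx
  have hmono : ∀ {m n : Fin k → ℕ}, m ≤ n → Submodule.span R
      ((fun q : KPath C × KPath C => Λ.s R q.1 * Λ.sStar R q.2) '' Λ.pairsOfDegree m) ≤
      Submodule.span R
      ((fun q : KPath C × KPath C => Λ.s R q.1 * Λ.sStar R q.2) '' Λ.pairsOfDegree n) := by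
    intro m n h
    rw [Submodule.span_le]
    rintro _ ⟨q, hq, rfl⟩
    exact Λ.s_mul_sStar_mem_span_pairs R (hq.2.le.trans h)
  induction hx using Submodule.span_induction with
  | mem x h =>
    obtain ⟨r, -, l, m, rfl⟩ := h
    exact ⟨_, Submodule.smul_mem _ _ (Λ.s_mul_sStar_mem_span_pairs R le_rfl)⟩
  | zero => exact ⟨0, Submodule.zero_mem _⟩
  | add x y _ _ hx hy =>
    obtain ⟨m, hm⟩ := hx
    obtain ⟨n, hn⟩ := hy
    exact ⟨m ⊔ n, Submodule.add_mem _ (hmono le_sup_left hm) (hmono le_sup_right hn)⟩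
  | smul r x _ hx => exact hx.imp fun n h => Submodule.smul_mem _ _ h

/-! ### Induction, restriction and the aperiodic cofinal case -/

variable {Λ R}

theorem mem_Ind {M : Ideal R} {x : Λ.KP R} : x ∈ Λ.Ind R M ↔ x ∈ Λ.indSpan R M :=
  TwoSidedIdeal.mem_mk' _ _ _ _ _ _ _

theorem Ind_mono {M N : Ideal R} (h : M ≤ N) : Λ.Ind R M ≤ Λ.Ind R N := by
  intro x hx
  rw [mem_Ind] at hx ⊢
  refine Submodule.span_mono ?_ hx
  rintro _ ⟨r, hr, l, m, rfl⟩
  exact ⟨r, h hr, l, m, rfl⟩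

theorem Res_mono {I J : TwoSidedIdeal (Λ.KP R)} (h : I ≤ J) : Λ.Res R I ≤ Λ.Res R J :=
  fun _ hr v => h (hr v)

theorem le_Res_Ind (M : Ideal R) : M ≤ Λ.Res R (Λ.Ind R M) := by
  intro r hr v
  rw [mem_Ind, ← p_mul_self, ← s_id]
  nth_rw 2 [s_id]
  rw [← sStar_id]
  exact Λ.mem_indSpan hr _ _

/-- Ideals are ideals of the ring only, so stability under scalars is not part of the definition;
the scalar `c` is absorbed into the ring element `c s_l`. -/
theorem smul_s_mul_sStar_mem {I : TwoSidedIdeal (Λ.KP R)} {r : R} (hr : r ∈ Λ.Res R I)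
    (c : R) (l m : KPath C) : c • r • (Λ.s R l * Λ.sStar R m) ∈ I := by
  have : c • r • (Λ.s R l * Λ.sStar R m) =
      (c • Λ.s R l) * (r • Λ.p R l.source) * Λ.sStar R m := by
    simp only [smul_mul_assoc, mul_smul_comm, Λ.s_mul_p, smul_comm c r]
  rw [this]
  exact I.mul_mem_right _ _ (I.mul_mem_left _ _ (hr _))

theorem Ind_Res_le (I : TwoSidedIdeal (Λ.KP R)) : Λ.Ind R (Λ.Res R I) ≤ I := by
  intro x hx
  rw [mem_Ind] at hx
  unfold indSpan at hx
  -- The span is treated as the additive closure of the scalar multiples of the generators, since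
  -- `I` is not yet known to be closed under scalars.
  induction hx using Submodule.closure_induction with
  | zero => exact I.zero_mem
  | add x y _ _ hx hy => exact I.add_mem hx hy
  | smul_mem c x h =>
    obtain ⟨r, hr, l, m, rfl⟩ := h
    exact smul_s_mul_sStar_mem hr c l m

/-- An ideal which is not contained in `Ind M` contains some `r p_v` with `r ∉ M`, if the graph is
aperiodic. -/
theorem Aperiodic.exists_smul_p_mem (hΛ : Λ.Aperiodic) {I : TwoSidedIdeal (Λ.KP R)} {M : Ideal R}
    (h : ¬ I ≤ Λ.Ind R M) : ∃ r ∉ M, ∃ v, r • Λ.p R v ∈ I := by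
  classical
  obtain ⟨x, hx, hxM⟩ := SetLike.not_le_iff_exists.1 h
  obtain ⟨n, hn⟩ := Λ.exists_mem_span_pairs R x
  obtain ⟨c, hc, rfl⟩ := (Finsupp.mem_span_image_iff_linearCombination R).1 hn
  rw [Finsupp.mem_supported] at hc
  rw [Finsupp.linearCombination_apply, Finsupp.sum] at hx hxM
  obtain ⟨⟨γ, δ⟩, hγδ, hcM⟩ : ∃ q ∈ c.support, c q ∉ M := by
    by_contra! hM
    exact hxM (mem_Ind.2 (Submodule.sum_mem _ fun q hq => Λ.mem_indSpan (hM q hq) _ _))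
  have hs : γ.source = δ.source := (hc hγδ).1
  have hδ : Λ.deg δ = n := (hc hγδ).2
  obtain ⟨l, hl, hort⟩ := hΛ.exists_orthogonal_finset R γ (c.support.image Prod.fst)
  have hl' : l.range = δ.source := hl.trans hs
  refine ⟨c (γ, δ), hcM, l.source, ?_⟩
  -- In this compression a term `s_α s_{β^*}` with `β ≠ δ` vanishes because `β` and `δ` have the
  -- same degree, and one with `β = δ`, `α ≠ γ` vanishes by the choice of `l`.
  have key : Λ.sStar R (cat γ l) * (∑ q ∈ c.support, c q • (Λ.s R q.1 * Λ.sStar R q.2)) *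
      Λ.s R (cat δ l) = c (γ, δ) • Λ.p R l.source := by
    rw [Finset.mul_sum, Finset.sum_mul, Finset.sum_eq_single (γ, δ)]
    · rw [mul_smul_comm, smul_mul_assoc, Λ.s_cat R hl', mul_assoc, mul_assoc,
        ← mul_assoc (Λ.sStar R δ), Λ.sStar_mul_s_self, ← hs, ← mul_assoc (Λ.s R γ), Λ.s_mul_p,
        ← Λ.s_cat R hl, Λ.sStar_mul_s_self, cat_source hl]
    · rintro ⟨α, β⟩ hq hne
      have hβ : Λ.deg β = n := (hc hq).2
      have hαβ : α.source = β.source := (hc hq).1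
      rw [mul_smul_comm, smul_mul_assoc, Λ.s_cat R hl', mul_assoc, mul_assoc,
        ← mul_assoc (Λ.sStar R β)]
      by_cases hβδ : β = δ
      · subst hβδ
        have hαγ : γ ≠ α := fun h => hne (by rw [h])
        have hsα : γ.source = α.source := hs.trans hαβ.symm
        rw [Λ.sStar_mul_s_self, ← hαβ, ← mul_assoc (Λ.s R α), Λ.s_mul_p,
          ← Λ.s_cat R (hl.trans hsα), hort α (Finset.mem_image_of_mem _ hq) hsα hαγ, smul_zero]
      · rw [Λ.sStar_mul_s_of_ne R (hβ.trans hδ.symm) hβδ, zero_mul, mul_zero, mul_zero, smul_zero]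
    · exact fun hn => absurd hγδ hn
  rw [← key]
  exact I.mul_mem_right _ _ (I.mul_mem_left _ _ hx)

/-- Heredity of the set of vertices `v` with `r p_v ∈ I`: compress by `s_{l^*}` and `s_l`. -/
theorem smul_p_mem_of_path {I : TwoSidedIdeal (Λ.KP R)} {r : R} (l : KPath C)
    (h : r • Λ.p R l.range ∈ I) : r • Λ.p R l.source ∈ I := by
  have : r • Λ.p R l.source = Λ.sStar R l * (r • Λ.p R l.range) * Λ.s R l := by
    rw [mul_smul_comm, smul_mul_assoc, Λ.sStar_mul_p, Λ.sStar_mul_s_self]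
  rw [this]
  exact I.mul_mem_right _ _ (I.mul_mem_left _ _ h)

/-- Saturation of the same set, from the expansion of `p_v` over the paths of degree `n`. -/
theorem smul_p_mem_of_forall {I : TwoSidedIdeal (Λ.KP R)} {r : R} {v : C} (n : Fin k → ℕ)
    (h : ∀ l : KPath C, l.range = v → Λ.deg l = n → r • Λ.p R l.source ∈ I) :
    r • Λ.p R v ∈ I := by
  rw [Λ.p_eq_sum R v n, Finset.smul_sum]
  refine sum_mem fun l hl => ?_
  obtain ⟨hl, hd⟩ := Λ.mem_pathsInto.1 hl
  have : r • (Λ.s R l * Λ.sStar R l) = Λ.s R l * (r • Λ.p R l.source) * Λ.sStar R l := by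
    rw [mul_smul_comm, smul_mul_assoc, Λ.s_mul_p]
  rw [this]
  exact I.mul_mem_right _ _ (I.mul_mem_left _ _ (h l hl hd))

theorem Cofinal.mem_Res (hΛ : Λ.Cofinal) {I : TwoSidedIdeal (Λ.KP R)} {r : R} {v : C}
    (h : r • Λ.p R v ∈ I) : r ∈ Λ.Res R I := by
  intro w
  by_contra hw
  -- By saturation, a vertex outside the set receives a path of degree `(1, …, 1)` from another such
  -- vertex, so some infinite path stays outside along the diagonal. Cofinality joins one of its
  -- vertices to `v`, and heredity then carries membership to a later diagonal vertex.
  obtain ⟨x, -, hx⟩ := IPath.exists_forall_source (Λ := Λ) (P := fun w => r • Λ.p R w ∉ I)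
    (fun w hw => by
      by_contra! H
      exact hw (smul_p_mem_of_forall 1 H)) hw
  obtain ⟨n, ⟨f⟩⟩ := hΛ x.toInfinitePath v
  refine hx (Finset.univ.sup n) ?_
  obtain ⟨g, -⟩ := x.exists_hom (m := n) (n := fun _ => Finset.univ.sup n)
    fun i => Finset.le_sup (Finset.mem_univ i)
  exact smul_p_mem_of_path ⟨g⟩ (smul_p_mem_of_path ⟨f⟩ h)

theorem Ind_Res_of_aperiodic_of_cofinal (ha : Λ.Aperiodic) (hc : Λ.Cofinal)
    (I : TwoSidedIdeal (Λ.KP R)) : Λ.Ind R (Λ.Res R I) = I := by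
  refine le_antisymm (Ind_Res_le I) ?_
  by_contra h
  obtain ⟨r, hr, v, hv⟩ := ha.exists_smul_p_mem h
  exact hr (hc.mem_Res hv)

/-- Scalars from `M` kill functions with values in `R ⧸ M`, so `Ind M` acts by zero on them.
Applying `r p_v` to the constant function `1` and evaluating at an infinite path of range `v` gives
the class of `r`, which must vanish. -/
theorem Res_Ind [Nonempty C] [Λ.NoSources] (M : Ideal R) : Λ.Res R (Λ.Ind R M) = M := by
  refine le_antisymm (fun r hr => ?_) (le_Res_Ind M)
  obtain ⟨v⟩ := ‹Nonempty C›
  obtain ⟨x, hx⟩ := IPath.exists_rng_eq (Λ := Λ) v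
  have hzero : ∀ y ∈ Λ.indSpan R M, (IPath.system Λ).rep R (R ⧸ M) y = 0 := by
    intro y hy
    unfold indSpan at hy
    induction hy using Submodule.span_induction with
    | zero => exact map_zero _
    | add a b _ _ ha hb => rw [map_add, ha, hb, add_zero]
    | smul c a _ ha => rw [BranchingSystem.rep_smul, ha, smul_zero]
    | mem y h =>
      obtain ⟨r, hr, l, m, rfl⟩ := h
      rw [BranchingSystem.rep_smul]
      ext1 f
      funext z
      obtain ⟨a, ha⟩ := Ideal.Quotient.mk_surjective
        ((IPath.system Λ).rep R (R ⧸ M) (Λ.s R l * Λ.sStar R m) f z)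
      rw [LinearMap.smul_apply, Pi.smul_apply, ← ha, LinearMap.zero_apply, Pi.zero_apply]
      exact Ideal.Quotient.eq_zero_iff_mem.2 (M.mul_mem_right a hr)
  have h := congrFun (LinearMap.congr_fun (hzero _ (mem_Ind.1 (hr v))) 1) x
  rw [BranchingSystem.rep_smul, LinearMap.smul_apply, Pi.smul_apply,
    BranchingSystem.rep_p_apply _ hx] at h
  have h' : Ideal.Quotient.mk M (r * 1) = 0 := h
  rwa [mul_one, Ideal.Quotient.eq_zero_iff_mem] at h'

/-! ### Faithfulness of representations and the converse implications -/

/-- If `Ind ∘ Res` is the identity, then each representation on a nonempty branching system is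
faithful. -/
theorem eq_zero_of_rep_eq_zero {X : Type*} [Nonempty X] (B : Λ.BranchingSystem X)
    (h : ∀ I : TwoSidedIdeal (Λ.KP R), Λ.Ind R (Λ.Res R I) = I) {x : Λ.KP R}
    (hx : B.rep R R x = 0) : x = 0 := by
  have hx' : x ∈ TwoSidedIdeal.ker (B.rep R R) := (TwoSidedIdeal.mem_ker _).2 hx
  -- A single point `y` suffices: there `r p_v`, for `v` the range of `y`, sends the constant
  -- function `1` to `r`.
  have hRes : Λ.Res R (TwoSidedIdeal.ker (B.rep R R)) = ⊥ := by
    refine (Submodule.eq_bot_iff _).2 fun r hr => ?_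
    obtain ⟨y⟩ := ‹Nonempty X›
    have h0 : B.rep R R (r • Λ.p R (B.rng y)) = 0 :=
      (TwoSidedIdeal.mem_ker _).1 (hr (B.rng y))
    have := congrFun (LinearMap.congr_fun h0 1) y
    rw [BranchingSystem.rep_smul, LinearMap.smul_apply, Pi.smul_apply,
      BranchingSystem.rep_p_apply _ rfl] at this
    simpa using this
  rw [← h (TwoSidedIdeal.ker _), hRes, mem_Ind] at hx'
  unfold indSpan at hx'
  have hle : Submodule.span R {x | ∃ r ∈ (⊥ : Ideal R), ∃ l m : KPath C,
      x = r • (Λ.s R l * Λ.sStar R m)} ≤ ⊥ := by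
    rw [Submodule.span_le]
    rintro _ ⟨r, hr, l, m, rfl⟩
    rw [(Submodule.mem_bot R).1 hr, zero_smul]
    rfl
  exact (Submodule.mem_bot R).1 (hle hx')

theorem p_ne_zero [Nontrivial R] [Λ.NoSources] (v : C) : Λ.p R v ≠ 0 := by
  intro h
  obtain ⟨x, hx⟩ := IPath.exists_rng_eq (Λ := Λ) v
  have h1 : (IPath.system Λ).rep R R (Λ.p R v) 1 x = 1 := BranchingSystem.rep_p_apply _ hx _
  rw [h, map_zero] at h1
  exact zero_ne_one h1

/-- Whether some vertex of an infinite path connects to `v` depends only on its tail, so the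
infinite paths with no such vertex form an invariant set, nonempty if cofinality fails. No path in
it has range `v`, so `p_v` acts by zero, against faithfulness. -/
theorem cofinal_of_Ind_Res [Nontrivial R] [Λ.NoSources]
    (h : ∀ I : TwoSidedIdeal (Λ.KP R), Λ.Ind R (Λ.Res R I) = I) : Λ.Cofinal := by
  intro x v
  by_contra! H
  have hinv : ∀ {l : KPath C} {y z : Λ.IPath}, (IPath.system Λ).Act l y z →
      ((∀ n, IsEmpty ((y n).source ⟶ v)) ↔ ∀ n, IsEmpty ((z n).source ⟶ v)) := by
    intro l y z hyz
    have hsrc : ∀ n, (z (Λ.deg l + n)).source = (y n).source := fun n => by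
      rw [hyz.2 n, cat_source ((y.range_apply n).trans hyz.1.symm)]
    constructor
    · intro hy n
      refine ⟨fun f => ?_⟩
      obtain ⟨g, -⟩ := z.exists_hom (le_add_self : n ≤ Λ.deg l + n)
      exact (hy n).false (eqToHom (hsrc n).symm ≫ g ≫ f)
    · intro hz n
      exact ⟨fun f => (hz (Λ.deg l + n)).false (eqToHom (hsrc n) ≫ f)⟩
  have : Nonempty {y : Λ.IPath // ∀ n, IsEmpty ((y n).source ⟶ v)} :=
    ⟨⟨.ofInfinitePath x, H⟩⟩
  refine Λ.p_ne_zero (R := R) v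
    (eq_zero_of_rep_eq_zero ((IPath.system Λ).restrict _ hinv) h ?_)
  rw [BranchingSystem.rep_p]
  refine LinearMap.pullRel_eq_zero ?_
  rintro ⟨y, hy⟩ _ ⟨rfl, hyv⟩
  have hyv' : y.rng = v := hyv
  have h0 : (y 0).source = v := by rw [y.apply_zero, hyv']
  exact (hy 0).false (eqToHom h0)

/-- On infinite paths the operators of `s_α` and `s_β` coincide, where `α` and `β` come from the
failure of aperiodicity; faithfulness forces `s_α = s_β`. The skew system remembers degrees and
tells them apart. -/
theorem aperiodic_of_Ind_Res [Nonempty C] [Nontrivial R] [Λ.NoSources]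
    (h : ∀ I : TwoSidedIdeal (Λ.KP R), Λ.Ind R (Λ.Res R I) = I) : Λ.Aperiodic := by
  by_contra hΛ
  obtain ⟨α, β, hs, hr, hd, H⟩ := Λ.exists_common_tails_of_not_aperiodic hΛ
  obtain ⟨y, hy⟩ := IPath.exists_rng_eq (Λ := Λ) α.source
  have : Nonempty Λ.IPath := ⟨y⟩
  have hact : ∀ y z, (IPath.system Λ).Act α y z ↔ (IPath.system Λ).Act β y z := by
    have hαβ : ∀ y z z', (IPath.system Λ).Act α y z → (IPath.system Λ).Act β y z' → z = z' := by
      intro y z z' hz hz'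
      refine IPath.ext_of_frequently fun n => ⟨n, le_rfl, ?_⟩
      -- The segments of degree `n` of `αy` and `βy` are already prefixes of `α y(n)` and `β y(n)`,
      -- so the common-tail property applies with `γ = y(n)`.
      refine H (y n) _ _ ?_ ?_ ?_ ?_ ?_
      · rw [y.range_apply]; exact hz.1.symm
      · rw [z.deg_toFun, y.deg_toFun]
      · rw [z'.deg_toFun, y.deg_toFun]
      · rw [← hz.2]; exact z.isPrefix le_add_self
      · rw [← hz'.2]; exact z'.isPrefix le_add_self
    intro y z
    constructor
    · intro hz
      obtain ⟨z', hz'⟩ := (IPath.system Λ).exists_act (hs.symm.trans hz.1)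
      rwa [hαβ y z z' hz hz']
    · intro hz
      obtain ⟨z', hz'⟩ := (IPath.system Λ).exists_act (hs.trans hz.1)
      rwa [← hαβ y z' z hz' hz]
  have heq : Λ.s R α = Λ.s R β := by
    rw [← sub_eq_zero]
    refine eq_zero_of_rep_eq_zero (IPath.system Λ) h ?_
    simp only [map_sub, BranchingSystem.rep_s, hact, sub_self]
  let B := (IPath.system Λ).skew
  obtain ⟨z, hz⟩ := B.exists_act (l := α) (y := (y, 0)) hy.symm
  classical
  -- The indicator of `(y, 0)`, evaluated at `z = α(y, 0)`. A factorization `z = βw` puts `w` at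
  -- height `d(α) - d(β) ≠ 0`, so `w` is not `(y, 0)`.
  let f : Λ.IPath × (Fin k → ℤ) → R := fun q => if q = (y, 0) then 1 else 0
  have h1 : B.rep R R (Λ.s R α) f z = 1 := by
    rw [BranchingSystem.rep_s, LinearMap.pullRel_apply (B.rightUnique_act_symm α) f hz]
    exact if_pos rfl
  have h2 : B.rep R R (Λ.s R β) f z = 0 := by
    rw [BranchingSystem.rep_s]
    by_cases hw : ∃ w, B.Act β w z
    · obtain ⟨w, hw⟩ := hw
      rw [LinearMap.pullRel_apply (B.rightUnique_act_symm β) f hw]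
      refine if_neg ?_
      rintro rfl
      refine hd (funext fun i => ?_)
      have := congrFun (hz.2.symm.trans hw.2) i
      simpa using this
    · push Not at hw
      exact LinearMap.pullRel_apply_of_not f hw
  rw [heq, h2] at h1
  exact zero_ne_one h1

end KGraph

theorem proposition6p4 {k : ℕ} (hk : 0 < k) {C : Type u} [Category.{v} C] [Nonempty C]
    (Λ : KGraph k C) [Λ.RowFinite] [Λ.NoSources] (R : Type w) [CommRing R] :
    ((∀ M : Ideal R, Λ.Res R (Λ.Ind R M) = M) ∧ Function.Injective (Λ.Ind R)) ∧
    (Λ.Aperiodic ∧ Λ.Cofinal →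
      (∀ I : TwoSidedIdeal (Λ.KP R), Λ.Ind R (Λ.Res R I) = I) ∧
      ∃ e : Ideal R ≃o TwoSidedIdeal (Λ.KP R), ⇑e = Λ.Ind R ∧ ⇑e.symm = Λ.Res R) ∧
    (Nontrivial R →
      (Λ.Aperiodic ∧ Λ.Cofinal ↔
        ∀ I : TwoSidedIdeal (Λ.KP R), Λ.Ind R (Λ.Res R I) = I)) := by
  refine ⟨⟨KGraph.Res_Ind, Function.LeftInverse.injective (KGraph.Res_Ind (Λ := Λ))⟩, fun h => ?_,
    fun _ => ⟨fun h => KGraph.Ind_Res_of_aperiodic_of_cofinal h.1 h.2,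
      fun h => ⟨KGraph.aperiodic_of_Ind_Res h, KGraph.cofinal_of_Ind_Res h⟩⟩⟩
  have hI := KGraph.Ind_Res_of_aperiodic_of_cofinal (R := R) h.1 h.2
  refine ⟨hI, ⟨⟨Λ.Ind R, Λ.Res R, KGraph.Res_Ind, hI⟩, fun {M N} => ⟨fun hMN => ?_,
    KGraph.Ind_mono⟩⟩, rfl, rfl⟩
  rw [← KGraph.Res_Ind (Λ := Λ) M, ← KGraph.Res_Ind (Λ := Λ) N]
  exact KGraph.Res_mono hMN
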